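/- Setting. Two players $\mathcal A,\mathcal B$ compete over $n\ge 1$ battlefields with values $v_j>0$; put $\phi=\sum_j v_j$. A mixed allocation is a probability distribution on $\mathbb R_{\ge0}^n$, and it is feasible for a budget $X$ if its expected total expenditure is at most $X$. When $\mathcal A$ and $\mathcal B$ use independent allocations, $u_{\mathcal A}$ is the expected total value of the battlefields on which $\mathcal A$'s amount is at least $\mathcal B$'s, and $u_{\mathcal B}=\phi-u_{\mathcal A}$. In the Bernoulli Lotto game $\mathrm{BL}(\mu,B)$, $\mathcal A$ has budget $A_h$ (type $h$) with probability $\mu$ and $A_\ell$ (type $\ell$) with probability $1-\mu$, where $A_h\ge A_\ell>0$; $\mathcal A$ knows its type, $\mathcal B$ does not and has the known budget $B\ge 0$. A Bayes–Nash equilibrium consists of one feasible mixed allocation for each type of $\mathcal A$ and one for $\mathcal B$, such that each type's allocation maximizes its own expected $u_{\mathcal A}$, and $\mathcal B$'s maximizes its expected $u_{\mathcal B}$ under the belief $\mu$. Write $\pi_{\mathcal A}(\mu,B;t)$ for type $t$'s payoff in equilibrium and $\pi_{\mathcal B}(\mu,B)$ for $\mathcal B$'s. In the signaling game with prior $p\in[0,1]$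 on type $h$ and per-unit cost $c>0$, $\mathcal A$ first commits to a signaling policy $\sigma$ with $\sigma(h|h)=1$, i.e. to a number $q=\sigma(h|\ell)\in[0,1]$. The type is drawn, a signal $s\in\{h,\ell\}$ is sent with probability $\sigma(s|t)$, and $\mathcal B$'s belief becomes $\mu_h=\frac{p}{p+q(1-p)}$ or $\mu_\ell=0$. Then $\mathcal B$ invests $B\ge0$ at cost $cB$, and $\mathrm{BL}(\mu_s,B)$ is played. A subgame perfect equilibrium (SPE) is a pair $(\sigma^*,B^*)$ such that for every policy and every signal $B^*(\mu_s)$ maximizes $\pi_{\mathcal B}(\mu_s,B)-cB$ over $B\ge0$, where $\mathcal B$ takes the smallest maximizer if there are several, and $\sigma^*$ maximizes $\Pi_{\mathcal A}(\sigma)=\mathbb E_t\,\mathbb E_{s\sim\sigma(\cdot|t)}\big[\pi_{\mathcal A}(\mu_s,B^*(\mu_s);t)\big]$. Let $\Pi^{\mathrm{ns}}_{\mathcal A}$ be the payoff $\Pi_{\mathcal A}$ of the trivial policy $q=1$. Put $$\bar A(p)=pA_h+(1-p)A_\ell,\quad \lambda(p)=\frac{\phi}{2A_h^2}\Big(\sqrt{(1-p)A_\ell}+\sqrt{pA_h+(1-p)A_\ell}\Big)^2,\quad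 f_p=\frac{p}{\sqrt{1-p}-(1-p)}.$$ Theorem. The games $\mathrm{BL}(\mu,B)$, for $\mu\in[0,1]$ and $B\ge0$, have Bayes–Nash equilibria. Whichever equilibria are selected to define $\pi_{\mathcal A}$ and $\pi_{\mathcal B}$, an SPE exists, and every SPE $(\sigma^*,B^*)$ satisfies $\Pi_{\mathcal A}(\sigma^*)>\Pi^{\mathrm{ns}}_{\mathcal A}$ if and only if $(c,p)$ satisfies one of the following (conditions 2 and 3 count as violated if $A_h=A_\ell$): 1. $\frac{\phi}{2A_h}\le c<\min\big\{\frac{\phi}{2\bar A(p)},\lambda(p)\big\}$ and $p>0$; 2. $\lambda(p)\le c$, $\ \frac{\phi}{2A_h}<c<\frac{\phi}{2(A_h-A_\ell)}$, $\ 0<p<\frac{A_h-2A_\ell}{A_h-A_\ell}$, and $f_p>\frac{\phi-2cA_\ell}{2cA_h-\phi}\cdot\frac{\sqrt{c\phi A_\ell/2}}{\phi-\sqrt{c\phi A_\ell/2}}$; 3. $\frac{\phi}{2(A_h-A_\ell)}\le c<\frac{(1-p)\phi}{2A_\ell}$, $\ \frac{\phi}{2A_\ell}\Big(\frac{f_p-\sqrt{f_p^2-f_p+1}}{f_p-1}\Big)^2<c$,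 and $0<p<\frac{A_h-2A_\ell}{A_h-A_\ell}$. The SPE signaling policy is $\sigma^*(h|\ell)=\frac{p}{1-p}\cdot\frac{2cA_h-\phi}{\phi-2cA_\ell}$ under condition 1 or 2, and $\sigma^*(h|\ell)=\frac{p}{1-p}\cdot\frac{2cA_\ell}{\phi-2cA_\ell}$ under condition 3. -/

import Mathlib

open MeasureTheory
open scoped NNReal ENNReal

namespace LottoSignaling

noncomputable section

/-- The two budget types of player A. The same two symbols serve as the two possible signals. -/
inductive BudgetType
  | high
  | low

/-- A mixed allocation: a joint distribution of nonnegative amounts on `n` battlefields. -/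
abbrev Mixed (n : ℕ) := ProbabilityMeasure (Fin n → ℝ≥0)

/-- The mixed allocations whose expected total expenditure is at most `A`. -/
def feasible (n : ℕ) (A : ℝ) : Set (Mixed n) :=
  {F | ∫⁻ x, ∑ j, (x j : ℝ≥0∞) ∂(F : Measure (Fin n → ℝ≥0)) ≤ ENNReal.ofReal A}

/-- Total value of the battlefields. -/
def totalValue {n : ℕ} (v : Fin n → ℝ) : ℝ := ∑ j, v j

/-- Expected value of the battlefields won by player A, ties being awarded to player A. -/
def payoffA {n : ℕ} (v : Fin n → ℝ) (FA FB : Mixed n) : ℝ :=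
  ∫ z, ∑ j, v j * (if z.2 j ≤ z.1 j then 1 else 0)
    ∂((FA : Measure (Fin n → ℝ≥0)).prod (FB : Measure (Fin n → ℝ≥0)))

/-- Expected value of the battlefields won by player B. -/
def payoffB {n : ℕ} (v : Fin n → ℝ) (FA FB : Mixed n) : ℝ :=
  totalValue v - payoffA v FA FB

/-- Strategy profile of a Bernoulli Lotto game: one mixed allocation for each type of A, and a
single one for B. -/
structure Profile (n : ℕ) where
  stratA : BudgetType → Mixed n
  stratB : Mixed n

/-- The budget of a type of player A. -/
def budget (Ah Al : ℝ) : BudgetType → ℝ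
  | .high => Ah
  | .low => Al

/-- Ex-interim utility of type `t` of player A. -/
def utilA {n : ℕ} (v : Fin n → ℝ) (S : Profile n) (t : BudgetType) : ℝ :=
  payoffA v (S.stratA t) S.stratB

/-- Expected utility of player B, who believes that A's type is high with probability `μ`. -/
def utilB {n : ℕ} (v : Fin n → ℝ) (μ : ℝ) (S : Profile n) : ℝ :=
  μ * payoffB v (S.stratA .high) S.stratB + (1 - μ) * payoffB v (S.stratA .low) S.stratB

/-- Bayes-Nash equilibrium of the Bernoulli Lotto game with type budgets `Ah`, `Al`, belief `μ`
on the high type, and budget `B` of player B. -/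
structure IsBNE {n : ℕ} (v : Fin n → ℝ) (Ah Al μ B : ℝ) (S : Profile n) : Prop where
  feasibleA : ∀ t, S.stratA t ∈ feasible n (budget Ah Al t)
  feasibleB : S.stratB ∈ feasible n B
  optimalA : ∀ t, ∀ F ∈ feasible n (budget Ah Al t),
    payoffA v F S.stratB ≤ utilA v S t
  optimalB : ∀ F ∈ feasible n B, utilB v μ ⟨S.stratA, F⟩ ≤ utilB v μ S

/-- `E μ B` is a Bayes-Nash equilibrium of the Stage 3 game for every belief `μ ∈ [0,1]` and every
investment `B ≥ 0`. -/
def IsEquilibriumSelection {n : ℕ} (v : Fin n → ℝ) (Ah Al : ℝ) (E : ℝ → ℝ → Profile n) : Prop :=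
  ∀ μ ∈ Set.Icc (0 : ℝ) 1, ∀ B, 0 ≤ B → IsBNE v Ah Al μ B (E μ B)

/-- A signaling policy `σ`, `prob s t = σ(s|t)`, that always signals high when the budget is
high. -/
structure SignalingPolicy where
  prob : BudgetType → BudgetType → ℝ
  nonneg : ∀ s t, 0 ≤ prob s t
  sum_eq_one : ∀ t, prob .high t + prob .low t = 1
  truthful : prob .high .high = 1

/-- The trivial policy: the signal is always high. -/
def trivialPolicy : SignalingPolicy where
  prob s _ := match s with
    | .high => 1
    | .low => 0
  nonneg s _ := by cases s <;> norm_num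
  sum_eq_one _ := by norm_num
  truthful := rfl

/-- Posterior belief on the high type after the signal `s` (Bayes' rule; it is `0` after the low
signal, also when the low signal has probability zero). -/
def posterior (p : ℝ) (σ : SignalingPolicy) (s : BudgetType) : ℝ :=
  p * σ.prob s .high / (p * σ.prob s .high + (1 - p) * σ.prob s .low)

/-- The investments that maximize B's equilibrium payoff minus cost, under the belief `μ`. -/
def optimalInvestments {n : ℕ} (v : Fin n → ℝ) (c : ℝ) (E : ℝ → ℝ → Profile n) (μ : ℝ) : Set ℝ :=
  {B | 0 ≤ B ∧ ∀ B', 0 ≤ B' → utilB v μ (E μ B') - c * B' ≤ utilB v μ (E μ B) - c * B}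

/-- Player A's expected final payoff under policy `σ` if B invests according to `Bstar`. -/
def expectedPayoff {n : ℕ} (v : Fin n → ℝ) (p : ℝ) (E : ℝ → ℝ → Profile n) (Bstar : ℝ → ℝ)
    (σ : SignalingPolicy) : ℝ :=
  let π (s t : BudgetType) : ℝ := utilA v (E (posterior p σ s) (Bstar (posterior p σ s))) t
  p * (σ.prob .high .high * π .high .high + σ.prob .low .high * π .low .high) +
    (1 - p) * (σ.prob .high .low * π .high .low + σ.prob .low .low * π .low .low)

/-- `(σ, Bstar)` is a subgame perfect equilibrium of the signaling game. -/
structure IsSPE {n : ℕ} (v : Fin n → ℝ) (p c : ℝ) (E : ℝ → ℝ → Profile n)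
    (σ : SignalingPolicy) (Bstar : ℝ → ℝ) : Prop where
  investment : ∀ (τ : SignalingPolicy) (s : BudgetType),
    Bstar (posterior p τ s) ∈ optimalInvestments v c E (posterior p τ s)
  signaling : ∀ τ : SignalingPolicy,
    expectedPayoff v p E Bstar τ ≤ expectedPayoff v p E Bstar σ

/-- When several investments are optimal, player B takes the smallest one. -/
def InvestsLeast {n : ℕ} (v : Fin n → ℝ) (p c : ℝ) (E : ℝ → ℝ → Profile n) (Bstar : ℝ → ℝ) :
    Prop :=
  ∀ (τ : SignalingPolicy) (s : BudgetType), ∀ B ∈ optimalInvestments v c E (posterior p τ s),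
    Bstar (posterior p τ s) ≤ B

/-- The expected budget of player A. -/
def meanBudget (Ah Al p : ℝ) : ℝ := p * Ah + (1 - p) * Al

/-- The threshold cost `λ(p)`. -/
def lam (φ Ah Al p : ℝ) : ℝ :=
  φ / (2 * Ah ^ 2) * (√((1 - p) * Al) + √(p * Ah + (1 - p) * Al)) ^ 2

/-- The quantity `f_p`. -/
def fp (p : ℝ) : ℝ := p / (√(1 - p) - (1 - p))

def Region1 (φ Ah Al c p : ℝ) : Prop :=
  0 < p ∧ φ / (2 * Ah) ≤ c ∧ c < min (φ / (2 * meanBudget Ah Al p)) (lam φ Ah Al p)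

def Region2 (φ Ah Al c p : ℝ) : Prop :=
  0 < p ∧ lam φ Ah Al p ≤ c ∧ φ / (2 * Ah) < c ∧ c < φ / (2 * (Ah - Al)) ∧
    p < (Ah - 2 * Al) / (Ah - Al) ∧
    (φ - 2 * c * Al) / (2 * c * Ah - φ) * (√(c * φ * Al / 2) / (φ - √(c * φ * Al / 2))) < fp p

def Region3 (φ Ah Al c p : ℝ) : Prop :=
  0 < p ∧ φ / (2 * (Ah - Al)) ≤ c ∧
    φ / (2 * Al) * ((fp p - √(fp p ^ 2 - fp p + 1)) / (fp p - 1)) ^ 2 < c ∧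
    c < (1 - p) * φ / (2 * Al) ∧ p < (Ah - 2 * Al) / (Ah - Al)

end

end LottoSignaling

open LottoSignaling

/-! For a fixed belief `μ` the Lotto game is constant-sum ex ante, and spreading a random total
proportionally to the values reduces it to a single battlefield. If the total has a distribution
function (averaged over types, for A) below an affine function, the opponent's payoff is at most
that function evaluated at the opponent's budget (`payoffA_proportional_le`,
`utilB_proportional_le`). Guarantees of the two players that add up to the total value form an
equilibrium (`exists_isBNE`). They also bound B's payoff in every equilibrium, since either side may
deviate to them. This is why the selection is irrelevant.

Put κ = c/φ, x = √(2κ), P = √(mean budget under μ) and R = √((1-μ)A_ℓ). B's largest net payoff, in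
units of φ, is max(1 - Px, 1 - μ - Rx, 0) (`exists_least_investment`). The attaining branch tells
whether B contests both types, the low type only, or nobody; `lam` marks the crossing of the first
two. A's share is then Px/2, μ + Rx/2 or 1, which is `residual`.

A policy matters only through the probability w = p + (1-p)q of the high signal, which ranges over
[p,1] and induces the belief p/w. Let W be `signalValue`. On the contested branches splitting the
belief does not help, by concavity of the residual (`signalValue_le_of_contests`). The residual
jumps to 1 where B abstains. If 2κA_ℓ < 1 ≤ 2κA_h and B contests under the prior, abstention means w
≤ w₀ for some w₀ < 1, and W is affine and increasing there, so only w₀ and 1 can be optimal.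

It remains to compare W(w₀) with W(1). If both types are contested under the prior, w₀ always wins
(`both_lt`). If only the low type is, the comparison is an inequality on f_p (`low_lt_iff`,
`root_sq_lt_iff`). Abstention imposes two constraints on w; whether 2κ(A_h - A_ℓ) is below 1 decides
which one binds, whence the two formulas for the policy. -/

namespace LottoSignaling

/-! ### Payoffs against proportional allocations -/

section Payoffs

variable {n : ℕ} {v : Fin n → ℝ}

/-- Player with a random total amount spends it proportionally to the battlefield values. -/
noncomputable def proportional (v : Fin n → ℝ) (G : ProbabilityMeasure ℝ≥0) : Mixed n :=
  G.map (f := fun x j => x * (v j / totalValue v).toNNReal)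
    (by fun_prop : Measurable fun (x : ℝ≥0) (j : Fin n) => x * (v j / totalValue v).toNNReal).aemeasurable

theorem totalValue_pos (hn : 0 < n) (hv : ∀ j, 0 < v j) : 0 < totalValue v :=
  Finset.sum_pos (fun j _ => hv j) ⟨⟨0, hn⟩, Finset.mem_univ _⟩

theorem measurableSet_le_coord (j : Fin n) :
    MeasurableSet {z : (Fin n → ℝ≥0) × (Fin n → ℝ≥0) | z.2 j ≤ z.1 j} :=
  measurableSet_le (by fun_prop) (by fun_prop)

theorem measurableSet_lt_coord (j : Fin n) :
    MeasurableSet {z : (Fin n → ℝ≥0) × (Fin n → ℝ≥0) | z.1 j < z.2 j} :=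
  measurableSet_lt (by fun_prop) (by fun_prop)

theorem payoffA_eq_sum (v : Fin n → ℝ) (FA FB : Mixed n) :
    payoffA v FA FB = ∑ j, v j * ((FA : Measure (Fin n → ℝ≥0)).prod
      (FB : Measure (Fin n → ℝ≥0))).real {z | z.2 j ≤ z.1 j} := by
  have h : ∀ (j : Fin n) (z : (Fin n → ℝ≥0) × (Fin n → ℝ≥0)),
      v j * (if z.2 j ≤ z.1 j then (1 : ℝ) else 0) =
        {z : (Fin n → ℝ≥0) × (Fin n → ℝ≥0) | z.2 j ≤ z.1 j}.indicator (fun _ => v j) z := by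
    intro j z
    simp [Set.indicator_apply]
  unfold payoffA
  simp_rw [h]
  rw [integral_finsetSum]
  · refine Finset.sum_congr rfl fun j _ => ?_
    rw [integral_indicator_const _ (measurableSet_le_coord j), smul_eq_mul, mul_comm]
  · intro j _
    exact (integrable_const _).indicator (measurableSet_le_coord j)

theorem payoffB_eq_sum (v : Fin n → ℝ) (FA FB : Mixed n) :
    payoffB v FA FB = ∑ j, v j * ((FA : Measure (Fin n → ℝ≥0)).prod
      (FB : Measure (Fin n → ℝ≥0))).real {z | z.1 j < z.2 j} := by
  rw [payoffB, payoffA_eq_sum, totalValue, ← Finset.sum_sub_distrib]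
  refine Finset.sum_congr rfl fun j _ => ?_
  have : {z : (Fin n → ℝ≥0) × (Fin n → ℝ≥0) | z.1 j < z.2 j} = {z | z.2 j ≤ z.1 j}ᶜ := by
    ext z; simp
  rw [this, probReal_compl_eq_one_sub (measurableSet_le_coord j)]
  ring

theorem payoffB_nonneg (hv : ∀ j, 0 < v j) (FA FB : Mixed n) : 0 ≤ payoffB v FA FB := by
  rw [payoffB_eq_sum]
  exact Finset.sum_nonneg fun j _ => mul_nonneg (hv j).le measureReal_nonneg

theorem proportional_apply (G : ProbabilityMeasure ℝ≥0) {s : Set (Fin n → ℝ≥0)}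
    (hs : MeasurableSet s) :
    (proportional v G : Measure (Fin n → ℝ≥0)) s =
      (G : Measure ℝ≥0) {x | (fun j => x * (v j / totalValue v).toNNReal) ∈ s} := by
  unfold proportional
  rw [ProbabilityMeasure.toMeasure_map, Measure.map_apply (by fun_prop) hs]
  rfl

theorem proportional_mem_feasible (hn : 0 < n) (hv : ∀ j, 0 < v j) {G : ProbabilityMeasure ℝ≥0} {A : ℝ}
    (hG : ∫⁻ x, (x : ℝ≥0∞) ∂(G : Measure ℝ≥0) ≤ ENNReal.ofReal A) :
    proportional v G ∈ feasible n A := by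
  have hφ := totalValue_pos hn hv
  show ∫⁻ x, ∑ j, (x j : ℝ≥0∞) ∂(proportional v G : Measure (Fin n → ℝ≥0)) ≤ _
  unfold proportional
  rw [ProbabilityMeasure.toMeasure_map, lintegral_map (by fun_prop) (by fun_prop)]
  refine le_trans (le_of_eq (lintegral_congr fun x => ?_)) hG
  have h1 : ∑ j, (v j / totalValue v).toNNReal = 1 := by
    rw [← Real.toNNReal_sum_of_nonneg fun j _ => (div_pos (hv j) hφ).le, ← Finset.sum_div,
      show ∑ j, v j = totalValue v from rfl, div_self hφ.ne', Real.toNNReal_one]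
  rw [← ENNReal.ofNNReal_finsetSum, ← Finset.mul_sum, h1, mul_one]

/-- Dividing the amount on battlefield `j` by its share v_j/φ and weighting by v_j leaves φ times
the amount. The sum over `j` therefore sees only total expenditure, which the budget controls. -/
theorem sum_lintegral_affine_le (hn : 0 < n) (hv : ∀ j, 0 < v j) {F : Mixed n} {A a b : ℝ}
    (hA : 0 ≤ A) (ha : 0 ≤ a) (hb : 0 ≤ b) (hF : F ∈ feasible n A) (m : Fin n → ℝ≥0∞)
    (hm : ∀ j, m j ≤ ∫⁻ x, ENNReal.ofReal (a + b * (x j / (v j / totalValue v)))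
      ∂(F : Measure (Fin n → ℝ≥0))) :
    ∑ j, v j * (m j).toReal ≤ totalValue v * (a + b * A) := by
  have hφ := totalValue_pos hn hv
  have key : ∑ j, ENNReal.ofReal (v j) * m j ≤ ENNReal.ofReal (totalValue v * (a + b * A)) := by
    calc ∑ j, ENNReal.ofReal (v j) * m j
        ≤ ∑ j, (ENNReal.ofReal (v j * a) + ENNReal.ofReal (b * totalValue v) *
            ∫⁻ x, (x j : ℝ≥0∞) ∂(F : Measure (Fin n → ℝ≥0))) := by
          refine Finset.sum_le_sum fun j _ => ?_
          refine (mul_le_mul_right (hm j) _).trans (le_of_eq ?_)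
          rw [← lintegral_const_mul _ (by fun_prop), ← lintegral_const_mul _ (by fun_prop)]
          have : ∀ x : Fin n → ℝ≥0, ENNReal.ofReal (v j) *
              ENNReal.ofReal (a + b * (x j / (v j / totalValue v))) =
              ENNReal.ofReal (v j * a) + ENNReal.ofReal (b * totalValue v) * (x j : ℝ≥0∞) := by
            intro x
            rw [← ENNReal.ofReal_mul (hv j).le, ← ENNReal.ofReal_coe_nnreal,
              ← ENNReal.ofReal_mul (by positivity),
              ← ENNReal.ofReal_add (mul_nonneg (hv j).le ha) (by positivity)]
            congr 1
            have := (hv j).ne'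
            field_simp
          simp_rw [this]
          rw [lintegral_add_left (by fun_prop), lintegral_const]
          simp
      _ = ENNReal.ofReal (totalValue v * a) + ENNReal.ofReal (b * totalValue v) *
            ∫⁻ x, ∑ j, (x j : ℝ≥0∞) ∂(F : Measure (Fin n → ℝ≥0)) := by
          rw [Finset.sum_add_distrib, ← Finset.mul_sum, lintegral_finsetSum _ (by fun_prop),
            ← ENNReal.ofReal_sum_of_nonneg fun j _ => mul_nonneg (hv j).le ha, ← Finset.sum_mul]
          rfl
      _ ≤ ENNReal.ofReal (totalValue v * a) + ENNReal.ofReal (b * totalValue v) *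
            ENNReal.ofReal A := by
          gcongr
          exact hF
      _ = _ := by
          rw [← ENNReal.ofReal_mul (by positivity), ← ENNReal.ofReal_add (by positivity)
            (by positivity)]
          congr 1
          ring
  have h2 := ENNReal.toReal_mono ENNReal.ofReal_ne_top key
  rw [ENNReal.toReal_ofReal (by positivity)] at h2
  refine le_trans (le_of_eq ?_) h2
  have hfin : ∑ j, ENNReal.ofReal (v j) * m j ≠ ∞ := ne_top_of_le_ne_top ENNReal.ofReal_ne_top key
  rw [ENNReal.toReal_sum (fun j hj => (ENNReal.sum_ne_top.1 hfin) j hj)]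
  refine Finset.sum_congr rfl fun j _ => ?_
  rw [ENNReal.toReal_mul, ENNReal.toReal_ofReal (hv j).le]

/-- Against a proportional allocation, winning battlefield `j` means that the amount there, divided
by the share of `j`, is at least the random total. The affine bound then integrates to a bound in
the budget alone. -/
theorem payoffA_proportional_le (hn : 0 < n) (hv : ∀ j, 0 < v j) {G : ProbabilityMeasure ℝ≥0}
    {F : Mixed n} {A a b : ℝ} (hA : 0 ≤ A) (ha : 0 ≤ a) (hb : 0 ≤ b) (hF : F ∈ feasible n A)
    (hG : ∀ x : ℝ≥0, (G : Measure ℝ≥0).real (Set.Iic x) ≤ a + b * x) :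
    payoffA v F (proportional v G) ≤ totalValue v * (a + b * A) := by
  have hφ := totalValue_pos hn hv
  rw [payoffA_eq_sum]
  refine sum_lintegral_affine_le hn hv hA ha hb hF _ fun j => ?_
  rw [Measure.prod_apply (measurableSet_le_coord j)]
  refine lintegral_mono fun x => ?_
  rw [proportional_apply _ (by exact measurable_prodMk_left (measurableSet_le_coord j))]
  have hr : 0 < v j / totalValue v := div_pos (hv j) hφ
  have h := hG (x j / (v j / totalValue v).toNNReal)
  rw [NNReal.coe_div, Real.coe_toNNReal _ hr.le] at h
  rw [← ENNReal.ofReal_toReal (measure_ne_top (G : Measure ℝ≥0) _)]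
  refine ENNReal.ofReal_le_ofReal (le_trans (le_of_eq ?_) h)
  rw [measureReal_def]
  congr 2
  ext y
  simp only [Set.mem_ofPred_eq, Set.mem_preimage, Set.mem_Iic]
  rw [le_div_iff₀ (by simpa using hr)]

/-- Only the type-averaged distribution function needs the affine bound, because B's single
allocation faces both types at once. Ties go to A, hence `Iio`. -/
theorem utilB_proportional_le (hn : 0 < n) (hv : ∀ j, 0 < v j) {Fh Fl : ProbabilityMeasure ℝ≥0}
    {F : Mixed n} {B α β μ : ℝ} (hB : 0 ≤ B) (hα : 0 ≤ α) (hβ : 0 ≤ β) (hμ0 : 0 ≤ μ) (hμ1 : μ ≤ 1)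
    (hF : F ∈ feasible n B)
    (hG : ∀ x : ℝ≥0, μ * (Fh : Measure ℝ≥0).real (Set.Iio x) +
      (1 - μ) * (Fl : Measure ℝ≥0).real (Set.Iio x) ≤ α + β * x) :
    μ * payoffB v (proportional v Fh) F + (1 - μ) * payoffB v (proportional v Fl) F ≤
      totalValue v * (α + β * B) := by
  have hφ := totalValue_pos hn hv
  rw [payoffB_eq_sum, payoffB_eq_sum, Finset.mul_sum, Finset.mul_sum, ← Finset.sum_add_distrib]
  have h := sum_lintegral_affine_le hn hv hB hα hβ hF
    (fun j => ENNReal.ofReal μ * ((proportional v Fh : Measure (Fin n → ℝ≥0)).prod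
        (F : Measure (Fin n → ℝ≥0))) {z | z.1 j < z.2 j} +
      ENNReal.ofReal (1 - μ) * ((proportional v Fl : Measure (Fin n → ℝ≥0)).prod
        (F : Measure (Fin n → ℝ≥0))) {z | z.1 j < z.2 j}) ?_
  · refine le_trans (le_of_eq (Finset.sum_congr rfl fun j _ => ?_)) h
    rw [ENNReal.toReal_add (by finiteness) (by finiteness), ENNReal.toReal_mul, ENNReal.toReal_mul,
      ENNReal.toReal_ofReal hμ0, ENNReal.toReal_ofReal (by linarith), measureReal_def,
      measureReal_def]
    ring
  · intro j
    have hm := measurableSet_lt_coord (n := n) j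
    rw [Measure.prod_apply_symm hm, Measure.prod_apply_symm hm,
      ← lintegral_const_mul _ (measurable_measure_prodMk_right hm),
      ← lintegral_const_mul _ (measurable_measure_prodMk_right hm),
      ← lintegral_add_left ((measurable_measure_prodMk_right hm).const_mul _)]
    refine lintegral_mono fun x => ?_
    simp only
    rw [proportional_apply _ (by exact measurable_prodMk_right hm),
      proportional_apply _ (by exact measurable_prodMk_right hm)]
    have hr : 0 < v j / totalValue v := div_pos (hv j) hφ
    have h := hG (x j / (v j / totalValue v).toNNReal)
    rw [NNReal.coe_div, Real.coe_toNNReal _ hr.le] at h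
    have hset : {y : ℝ≥0 | (fun i => y * (v i / totalValue v).toNNReal) ∈
        (fun z => (z, x)) ⁻¹' {z : (Fin n → ℝ≥0) × (Fin n → ℝ≥0) | z.1 j < z.2 j}} =
        Set.Iio (x j / (v j / totalValue v).toNNReal) := by
      ext y
      simp only [Set.mem_ofPred_eq, Set.mem_preimage, Set.mem_Iio]
      rw [lt_div_iff₀ (by simpa using hr)]
    rw [hset]
    rw [← ENNReal.ofReal_toReal (measure_ne_top (Fh : Measure ℝ≥0) _),
      ← ENNReal.ofReal_toReal (measure_ne_top (Fl : Measure ℝ≥0) _),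
      ← ENNReal.ofReal_mul hμ0, ← ENNReal.ofReal_mul (by linarith),
      ← ENNReal.ofReal_add (by positivity)
        (mul_nonneg (by linarith) ENNReal.toReal_nonneg)]
    exact ENNReal.ofReal_le_ofReal h

/-- Lower bound on the payoff of a sure total amount against a proportional allocation. -/
theorem le_payoffA_dirac (hn : 0 < n) (hv : ∀ j, 0 < v j) {G : ProbabilityMeasure ℝ≥0} {x : ℝ≥0}
    {F : ProbabilityMeasure ℝ≥0} (hF : (F : Measure ℝ≥0) = Measure.dirac x) :
    totalValue v * (G : Measure ℝ≥0).real (Set.Iic x) ≤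
      payoffA v (proportional v F) (proportional v G) := by
  have hφ := totalValue_pos hn hv
  rw [payoffA_eq_sum, totalValue, Finset.sum_mul]
  refine Finset.sum_le_sum fun j _ => ?_
  refine mul_le_mul_of_nonneg_left (le_of_eq ?_) (hv j).le
  have hm := measurableSet_le_coord (n := n) j
  have h1 : (proportional v F : Measure (Fin n → ℝ≥0)) =
      Measure.dirac (fun j => x * (v j / totalValue v).toNNReal) := by
    unfold proportional
    rw [ProbabilityMeasure.toMeasure_map, hF]
    exact Measure.map_dirac' (by fun_prop) _
  rw [measureReal_def, measureReal_def, Measure.prod_apply hm, h1,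
    lintegral_dirac' _ (measurable_measure_prodMk_left hm),
    proportional_apply _ (measurable_prodMk_left hm)]
  congr 2
  ext y
  simp only [Set.mem_ofPred_eq, Set.mem_preimage, Set.mem_Iic]
  rw [mul_le_mul_iff_left₀ (by simpa using div_pos (hv j) hφ)]

end Payoffs

/-! ### Distributions of total amounts and the guarantees of player A -/

section Laws

/-- The mean of a distribution of total amounts is at most `A`. -/
def MeanLE (P : ProbabilityMeasure ℝ≥0) (A : ℝ) : Prop :=
  ∫⁻ x, (x : ℝ≥0∞) ∂(P : Measure ℝ≥0) ≤ ENNReal.ofReal A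

/-- Law of `q` evaluated at a uniform random variable on `[0,1]`. -/
noncomputable def quantileLaw (q : C(ℝ, ℝ)) : ProbabilityMeasure ℝ≥0 :=
  ⟨((volume : Measure ℝ).restrict (Set.Icc 0 1)).map (fun w => (q w).toNNReal), by
    have : IsProbabilityMeasure ((volume : Measure ℝ).restrict (Set.Icc 0 1)) := ⟨by simp⟩
    exact Measure.isProbabilityMeasure_map (by fun_prop)⟩

theorem toMeasure_quantileLaw (q : C(ℝ, ℝ)) : (quantileLaw q : Measure ℝ≥0) =
    ((volume : Measure ℝ).restrict (Set.Icc 0 1)).map (fun w => (q w).toNNReal) := rfl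

theorem quantileLaw_real {q : C(ℝ, ℝ)} {s : Set ℝ≥0} (hs : MeasurableSet s) :
    (quantileLaw q : Measure ℝ≥0).real s =
      (volume : Measure ℝ).real {w | w ∈ Set.Icc (0 : ℝ) 1 ∧ (q w).toNNReal ∈ s} := by
  have hm : Measurable fun w => (q w).toNNReal := by fun_prop
  rw [toMeasure_quantileLaw, measureReal_def, Measure.map_apply hm hs,
    Measure.restrict_apply (hm hs), measureReal_def]
  congr 2
  ext w
  simp [and_comm]

theorem meanLE_quantileLaw {q : C(ℝ, ℝ)} (hq : ∀ w, 0 ≤ w → 0 ≤ q w) {A : ℝ}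
    (hA : ∫ w in (0 : ℝ)..1, q w ≤ A) : MeanLE (quantileLaw q) A := by
  unfold MeanLE
  rw [toMeasure_quantileLaw, lintegral_map (by fun_prop) (by fun_prop)]
  rw [intervalIntegral.integral_of_le zero_le_one, ← integral_Icc_eq_integral_Ioc] at hA
  refine le_trans (le_of_eq ?_) (ENNReal.ofReal_le_ofReal hA)
  rw [ofReal_integral_eq_lintegral_ofReal]
  · rfl
  · exact q.continuous.continuousOn.integrableOn_compact isCompact_Icc
  · exact (ae_restrict_mem measurableSet_Icc).mono fun w hw => hq w hw.1

/-- The mixture `(1 - θ) P + θ Q`. -/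
noncomputable def mix (θ : Set.Icc (0 : ℝ) 1) (P Q : ProbabilityMeasure ℝ≥0) :
    ProbabilityMeasure ℝ≥0 :=
  ⟨ENNReal.ofReal (1 - θ) • (P : Measure ℝ≥0) + ENNReal.ofReal θ • (Q : Measure ℝ≥0), ⟨by
    simp only [Measure.coe_add, Measure.coe_smul, Pi.add_apply, Pi.smul_apply, measure_univ,
      smul_eq_mul, mul_one]
    rw [← ENNReal.ofReal_add (by linarith [θ.2.2]) θ.2.1]
    simp⟩⟩

theorem mix_real (θ : Set.Icc (0 : ℝ) 1) (P Q : ProbabilityMeasure ℝ≥0) (s : Set ℝ≥0) :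
    (mix θ P Q : Measure ℝ≥0).real s =
      (1 - θ) * (P : Measure ℝ≥0).real s + θ * (Q : Measure ℝ≥0).real s := by
  show (ENNReal.ofReal (1 - θ) • (P : Measure ℝ≥0) + ENNReal.ofReal θ • (Q : Measure ℝ≥0)).real s = _
  rw [measureReal_def, Measure.add_apply, Measure.smul_apply, Measure.smul_apply, smul_eq_mul,
    smul_eq_mul, ENNReal.toReal_add (by finiteness) (by finiteness), ENNReal.toReal_mul,
    ENNReal.toReal_mul, ENNReal.toReal_ofReal θ.2.1, ENNReal.toReal_ofReal (by linarith [θ.2.2]),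
    measureReal_def, measureReal_def]

theorem meanLE_mix {θ : Set.Icc (0 : ℝ) 1} {P Q : ProbabilityMeasure ℝ≥0} {A A' A'' : ℝ}
    (hA0 : 0 ≤ A) (hA0' : 0 ≤ A') (hP : MeanLE P A) (hQ : MeanLE Q A')
    (h : (1 - θ) * A + θ * A' ≤ A'') : MeanLE (mix θ P Q) A'' := by
  have h0 : (0 : ℝ) ≤ θ := θ.2.1
  have h1 : (0 : ℝ) ≤ 1 - θ := by linarith [θ.2.2]
  show ∫⁻ x, (x : ℝ≥0∞) ∂(ENNReal.ofReal (1 - θ) • (P : Measure ℝ≥0) +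
    ENNReal.ofReal θ • (Q : Measure ℝ≥0)) ≤ _
  rw [lintegral_add_measure, lintegral_smul_measure, lintegral_smul_measure]
  refine le_trans ?_ (ENNReal.ofReal_le_ofReal h)
  rw [ENNReal.ofReal_add (by positivity) (by positivity), ENNReal.ofReal_mul h1,
    ENNReal.ofReal_mul h0]
  exact add_le_add (mul_le_mul_right hP _) (mul_le_mul_right hQ _)

/-- The uniform law on `[0, s]`. -/
noncomputable def uniformLaw (s : ℝ) : ProbabilityMeasure ℝ≥0 :=
  quantileLaw ⟨fun w => s * w, by fun_prop⟩

theorem meanLE_uniformLaw {s : ℝ} (hs : 0 ≤ s) : MeanLE (uniformLaw s) (s / 2) := by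
  refine meanLE_quantileLaw (fun w hw => mul_nonneg hs hw) (le_of_eq ?_)
  simp only [ContinuousMap.coe_mk]
  rw [intervalIntegral.integral_const_mul, integral_id]
  ring

theorem mul_uniformLaw_Iic_le {s : ℝ} (hs : 0 ≤ s) (x : ℝ≥0) :
    s * (uniformLaw s : Measure ℝ≥0).real (Set.Iic x) ≤ x := by
  rcases hs.eq_or_lt with rfl | hs
  · simp
  unfold uniformLaw
  rw [quantileLaw_real measurableSet_Iic]
  have : (volume : Measure ℝ).real {w | w ∈ Set.Icc (0 : ℝ) 1 ∧ (s * w).toNNReal ∈ Set.Iic x} ≤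
      (volume : Measure ℝ).real (Set.Icc 0 (x / s)) := by
    refine measureReal_mono (fun w hw => ⟨hw.1.1, ?_⟩) (by simp)
    have := hw.2
    rw [Set.mem_Iic, Real.toNNReal_le_iff_le_coe] at this
    rw [le_div_iff₀ hs]
    linarith
  rw [Real.volume_real_Icc_of_le (by positivity)] at this
  calc s * _ ≤ s * (x / s - 0) := mul_le_mul_of_nonneg_left this hs.le
    _ = x := by field_simp; ring

theorem le_mul_uniformLaw_Iic {s : ℝ} (hs : 0 ≤ s) (x : ℝ≥0) :
    min s x ≤ s * (uniformLaw s : Measure ℝ≥0).real (Set.Iic x) := by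
  rcases hs.eq_or_lt with rfl | hs
  · simp
  unfold uniformLaw
  rw [quantileLaw_real measurableSet_Iic]
  have : (volume : Measure ℝ).real (Set.Icc 0 (min s x / s)) ≤ (volume : Measure ℝ).real
      {w | w ∈ Set.Icc (0 : ℝ) 1 ∧ (s * w).toNNReal ∈ Set.Iic x} := by
    refine measureReal_mono (fun w hw => ⟨⟨hw.1, ?_⟩, ?_⟩) ?_
    · exact hw.2.trans ((div_le_one hs).2 (min_le_left _ _))
    · rw [Set.mem_Iic, Real.toNNReal_le_iff_le_coe]
      have := hw.2
      rw [le_div_iff₀ hs] at this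
      linarith [min_le_right s (x : ℝ)]
    · refine ne_top_of_le_ne_top ?_ (measure_mono fun w hw => hw.1)
      simp
  rw [Real.volume_real_Icc_of_le (by positivity)] at this
  calc min s x = s * (min s x / s - 0) := by field_simp; ring
    _ ≤ _ := mul_le_mul_of_nonneg_left this hs.le

theorem uniformLaw_zero_Iic (x : ℝ≥0) : (uniformLaw 0 : Measure ℝ≥0).real (Set.Iic x) = 1 := by
  unfold uniformLaw
  rw [quantileLaw_real measurableSet_Iic]
  have : {w : ℝ | w ∈ Set.Icc (0 : ℝ) 1 ∧ ((⟨fun w => 0 * w, by fun_prop⟩ : C(ℝ, ℝ)) w).toNNReal ∈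
      Set.Iic x} = Set.Icc 0 1 := by
    ext w; simp
  rw [this]
  simp

/-- Law of the positive part of a uniform variable on `[a - α, a + b - α]`, scaled by `1/β`. -/
noncomputable def bandLaw (α β a b : ℝ) : ProbabilityMeasure ℝ≥0 :=
  quantileLaw ⟨fun w => max (a + b * w - α) 0 / β, by fun_prop⟩

/-- The mean of `bandLaw α β a b`. -/
noncomputable def bandMean (α β a b : ℝ) : ℝ :=
  ∫ w in (0 : ℝ)..1, max (a + b * w - α) 0 / β

/-- Supplies the antiderivative for `mul_bandMean`; the kink at zero is harmless because the error
there is quadratic. -/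
theorem hasDerivAt_max_zero_sq (y : ℝ) :
    HasDerivAt (fun y : ℝ => max y 0 ^ 2 / 2) (max y 0) y := by
  rcases lt_trichotomy y 0 with h | rfl | h
  · rw [max_eq_right h.le]
    refine (hasDerivAt_const y (0 : ℝ)).congr_of_eventuallyEq ?_
    filter_upwards [eventually_lt_nhds h] with z hz
    simp [max_eq_right hz.le]
  · rw [max_self, hasDerivAt_iff_isLittleO_nhds_zero]
    simp only [zero_add, max_self, smul_zero, sub_zero]
    refine Asymptotics.IsBigO.trans_isLittleO (g := fun h : ℝ => h ^ 2) ?_ ?_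
    · refine Asymptotics.isBigO_of_le _ fun z => ?_
      rw [zero_pow two_ne_zero, zero_div, sub_zero]
      rw [Real.norm_of_nonneg (by positivity), Real.norm_of_nonneg (by positivity)]
      rcases le_total z 0 with hz | hz
      · simp [max_eq_right hz]; positivity
      · simp [max_eq_left hz]; nlinarith [sq_nonneg z]
    · simpa using Asymptotics.isLittleO_pow_id (𝕜 := ℝ) (n := 2) (by norm_num)
  · rw [max_eq_left h.le]
    have : HasDerivAt (fun y : ℝ => y ^ 2 / 2) y y := by
      simpa using (hasDerivAt_pow 2 y).div_const 2
    refine this.congr_of_eventuallyEq ?_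
    filter_upwards [eventually_gt_nhds h] with z hz
    simp [max_eq_left hz.le]

/-- The factor `b` stays on the left so that the formula survives bands of width zero, which occur
for degenerate beliefs. -/
theorem mul_bandMean (α β a b : ℝ) :
    b * bandMean α β a b = (max (a + b - α) 0 ^ 2 - max (a - α) 0 ^ 2) / (2 * β) := by
  have h : ∀ w ∈ Set.uIcc (0 : ℝ) 1, HasDerivAt (fun w => max (a + b * w - α) 0 ^ 2 / 2)
      (max (a + b * w - α) 0 * b) w := by
    intro w _
    have h1 : HasDerivAt (fun w : ℝ => a + b * w - α) b w := by
      simpa using (((hasDerivAt_id w).const_mul b).const_add a).sub_const α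
    exact (hasDerivAt_max_zero_sq (a + b * w - α)).comp w h1
  have := intervalIntegral.integral_eq_sub_of_hasDerivAt h
    (Continuous.intervalIntegrable (by fun_prop) _ _)
  rw [intervalIntegral.integral_mul_const] at this
  unfold bandMean
  rw [intervalIntegral.integral_div, mul_div_assoc', mul_comm b, this]
  simp only [mul_one, mul_zero, add_zero]
  ring

theorem bandMean_nonneg {β : ℝ} (hβ : 0 < β) (α a b : ℝ) : 0 ≤ bandMean α β a b :=
  intervalIntegral.integral_nonneg zero_le_one fun _ _ => by positivity

theorem meanLE_bandLaw {β : ℝ} (hβ : 0 < β) (α a b : ℝ) :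
    MeanLE (bandLaw α β a b) (bandMean α β a b) :=
  meanLE_quantileLaw (fun w _ => by simp only [ContinuousMap.coe_mk]; positivity) le_rfl

theorem mul_bandLaw_Iio_le {α β a b : ℝ} (hβ : 0 < β) (hb : 0 ≤ b) (x : ℝ≥0) :
    b * (bandLaw α β a b : Measure ℝ≥0).real (Set.Iio x) ≤ max (α + β * x - a) 0 := by
  rcases hb.eq_or_lt with rfl | hb
  · simp
  unfold bandLaw
  rw [quantileLaw_real measurableSet_Iio]
  have : (volume : Measure ℝ).real {w | w ∈ Set.Icc (0 : ℝ) 1 ∧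
      (max (a + b * w - α) 0 / β).toNNReal ∈ Set.Iio x} ≤
      (volume : Measure ℝ).real (Set.Ico 0 ((α + β * x - a) / b)) := by
    refine measureReal_mono (fun w hw => ⟨hw.1.1, ?_⟩) (by simp)
    have := hw.2
    rw [Set.mem_Iio, Real.toNNReal_lt_iff_lt_coe (by positivity), div_lt_iff₀ hβ] at this
    rw [lt_div_iff₀ hb]
    linarith [le_max_left (a + b * w - α) 0]
  rw [Real.volume_real_Ico] at this
  calc b * _ ≤ b * max ((α + β * x - a) / b - 0) 0 := mul_le_mul_of_nonneg_left this hb.le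
    _ = max (α + β * x - a) 0 := by
      rw [mul_max_of_nonneg _ _ hb.le]
      congr 1
      · field_simp; ring
      · ring

/-- Player A has distributions of total amounts, within the budgets, such that the total amount of
A is below `x` with probability at most `α + β x`. -/
def Guarantee (Ah Al μ α β : ℝ) (Fh Fl : ProbabilityMeasure ℝ≥0) : Prop :=
  MeanLE Fh Ah ∧ MeanLE Fl Al ∧ ∀ x : ℝ≥0, μ * (Fh : Measure ℝ≥0).real (Set.Iio x) +
      (1 - μ) * (Fl : Measure ℝ≥0).real (Set.Iio x) ≤ α + β * x

/-- A's averaged total should have quantile function (w - α)⁺/β. Either both types use this law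
(pooling), or the low type takes the quantiles in [0, 1-μ] and the high type those in [1-μ, 1]
(separation). Mixing the two keeps the average law and shifts spending between the types. `hall`
makes the average affordable and `hlow` makes the low type's share affordable under separation. -/
theorem exists_guarantee {Ah Al μ α β : ℝ} (hAl : 0 < Al) (hAh : Al ≤ Ah) (hμ0 : 0 ≤ μ)
    (hμ1 : μ ≤ 1) (hα0 : 0 ≤ α) (hα1 : α ≤ 1) (hβ : 0 < β)
    (hall : (1 - α) ^ 2 ≤ 2 * β * meanBudget Ah Al μ)
    (hlow : max (1 - μ - α) 0 ^ 2 ≤ 2 * β * ((1 - μ) * Al)) :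
    ∃ Fh Fl, Guarantee Ah Al μ α β Fh Fl := by
  have hM := mul_bandMean α β 0 1
  have hH := mul_bandMean α β (1 - μ) μ
  have hL := mul_bandMean α β 0 (1 - μ)
  have hM0 := bandMean_nonneg hβ α 0 1
  have hH0 := bandMean_nonneg hβ α (1 - μ) μ
  have hL0 := bandMean_nonneg hβ α 0 (1 - μ)
  have hz : max (0 - α) 0 = 0 := max_eq_right (by linarith)
  have h1 : max (1 - α) 0 = 1 - α := max_eq_left (by linarith)
  rw [zero_add, hz, h1, one_mul] at hM
  rw [sub_add_cancel, h1] at hH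
  rw [zero_add, hz] at hL
  have hMle : bandMean α β 0 1 ≤ meanBudget Ah Al μ := by
    rw [hM, div_le_iff₀ (by positivity)]
    linarith
  have hsum : μ * bandMean α β (1 - μ) μ + (1 - μ) * bandMean α β 0 (1 - μ) =
      bandMean α β 0 1 := by
    rw [hM, hH, hL]; ring
  have hcdf : ∀ (t : Set.Icc (0 : ℝ) 1) (x : ℝ≥0),
      μ * (mix t (bandLaw α β 0 1) (bandLaw α β (1 - μ) μ) : Measure ℝ≥0).real (Set.Iio x) +
      (1 - μ) * (mix t (bandLaw α β 0 1) (bandLaw α β 0 (1 - μ)) : Measure ℝ≥0).real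
        (Set.Iio x) ≤ α + β * x := by
    intro t x
    have ht0 : (0 : ℝ) ≤ t := t.2.1
    have ht1 : (0 : ℝ) ≤ 1 - t := by linarith [t.2.2]
    have hy : 0 ≤ α + β * x := by positivity
    have e1 := mul_bandLaw_Iio_le (α := α) (a := 0) (b := 1) hβ zero_le_one x
    have e2 := mul_bandLaw_Iio_le (α := α) (a := 1 - μ) hβ hμ0 x
    have e3 := mul_bandLaw_Iio_le (α := α) (a := 0) hβ (sub_nonneg.2 hμ1) x
    have e4 : (bandLaw α β (1 - μ) μ : Measure ℝ≥0).real (Set.Iio x) ≤ 1 := measureReal_le_one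
    have e5 : (bandLaw α β 0 (1 - μ) : Measure ℝ≥0).real (Set.Iio x) ≤ 1 := measureReal_le_one
    rw [one_mul, sub_zero, max_eq_left hy] at e1
    rw [sub_zero, max_eq_left hy] at e3
    rw [mix_real, mix_real]
    have e6 : μ * (bandLaw α β (1 - μ) μ : Measure ℝ≥0).real (Set.Iio x) +
        (1 - μ) * (bandLaw α β 0 (1 - μ) : Measure ℝ≥0).real (Set.Iio x) ≤ α + β * x := by
      -- Under separation the high type stays out until the low type's mass 1-μ is exhausted, so at
      -- each level only one band is growing.
      rcases le_total (α + β * x) (1 - μ) with h | h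
      · rw [max_eq_right (by linarith)] at e2
        linarith
      · rw [max_eq_left (by linarith)] at e2
        nlinarith
    nlinarith [mul_le_mul_of_nonneg_left e1 ht1, mul_le_mul_of_nonneg_left e6 ht0]
  -- Full separation if the high type can afford it; otherwise the weight `t` makes the high type
  -- spend exactly `Ah`, and the low type's mean follows from that of the average.
  rcases le_or_gt (bandMean α β (1 - μ) μ) Ah with h | h
  · refine ⟨_, _, ?_, ?_, hcdf ⟨1, by norm_num⟩⟩
    · refine meanLE_mix hM0 hH0 (meanLE_bandLaw hβ _ _ _) (meanLE_bandLaw hβ _ _ _) ?_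
      simpa using h
    · refine meanLE_mix hM0 hL0 (meanLE_bandLaw hβ _ _ _) (meanLE_bandLaw hβ _ _ _) ?_
      simp only [sub_self, zero_mul, one_mul, zero_add]
      rcases hμ1.eq_or_lt with rfl | hμ
      · unfold bandMean
        simp only [sub_self, zero_mul, zero_add, zero_sub]
        rw [max_eq_right (by linarith)]
        simpa using hAl.le
      · have : 0 < 1 - μ := by linarith
        rw [← mul_le_mul_iff_right₀ this, hL, div_le_iff₀ (by positivity)]
        linarith
  · have hmean : meanBudget Ah Al μ ≤ Ah := by
      unfold meanBudget; nlinarith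
    have hlt : bandMean α β 0 1 < bandMean α β (1 - μ) μ := by linarith
    have hpos : 0 < bandMean α β (1 - μ) μ - bandMean α β 0 1 := by linarith
    have ht : (Ah - bandMean α β 0 1) / (bandMean α β (1 - μ) μ - bandMean α β 0 1) ∈
        Set.Icc (0 : ℝ) 1 :=
      ⟨div_nonneg (by linarith) hpos.le, (div_le_one hpos).2 (by linarith)⟩
    set t : Set.Icc (0 : ℝ) 1 := ⟨_, ht⟩ with htdef
    have htv : (t : ℝ) * (bandMean α β (1 - μ) μ - bandMean α β 0 1) = Ah - bandMean α β 0 1 :=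
      div_mul_cancel₀ _ hpos.ne'
    refine ⟨_, _, ?_, ?_, hcdf t⟩
    · refine meanLE_mix hM0 hH0 (meanLE_bandLaw hβ _ _ _) (meanLE_bandLaw hβ _ _ _) ?_
      linarith
    · refine meanLE_mix hM0 hL0 (meanLE_bandLaw hβ _ _ _) (meanLE_bandLaw hβ _ _ _) ?_
      rcases hμ1.eq_or_lt with rfl | hμ
      · exfalso; linarith
      · have : 0 < 1 - μ := by linarith
        rw [← mul_le_mul_iff_right₀ this]
        have e : (1 - μ) * ((1 - t) * bandMean α β 0 1 + t * bandMean α β 0 (1 - μ)) =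
            bandMean α β 0 1 - μ * Ah := by
          linear_combination (t : ℝ) * hsum - μ * htv
        rw [e]
        unfold meanBudget at hMle
        linarith

end Laws

/-! ### Existence of Bayes-Nash equilibria and bounds valid in all of them -/

section Equilibria

variable {n : ℕ} {v : Fin n → ℝ}

/-- The distribution function of `G` is at most `a + b x`. -/
def CdfLE (G : ProbabilityMeasure ℝ≥0) (a b : ℝ) : Prop :=
  ∀ x : ℝ≥0, (G : Measure ℝ≥0).real (Set.Iic x) ≤ a + b * x

theorem cdfLE_one (G : ProbabilityMeasure ℝ≥0) : CdfLE G 1 0 := fun x => by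
  have : (G : Measure ℝ≥0).real (Set.Iic x) ≤ 1 := measureReal_le_one
  linarith

theorem uniformLaw_Iic_le {s : ℝ} (hs : 0 < s) (x : ℝ≥0) :
    (uniformLaw s : Measure ℝ≥0).real (Set.Iic x) ≤ 1 / s * x := by
  have := mul_uniformLaw_Iic_le hs.le x
  rw [one_div_mul_eq_div, le_div_iff₀ hs]
  linarith

theorem cdfLE_uniformLaw {s : ℝ} (hs : 0 < s) : CdfLE (uniformLaw s) 0 (1 / s) := fun x => by
  linarith [uniformLaw_Iic_le hs x]

theorem cdfLE_mix (θ : Set.Icc (0 : ℝ) 1) {S : ℝ} (hS : 0 < S) (Q : ProbabilityMeasure ℝ≥0) :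
    CdfLE (mix θ (uniformLaw S) Q) θ ((1 - θ) / S) := fun x => by
  have h1 := uniformLaw_Iic_le hS x
  have h2 : (Q : Measure ℝ≥0).real (Set.Iic x) ≤ 1 := measureReal_le_one
  rw [mix_real]
  have := mul_le_mul_of_nonneg_left h1 (sub_nonneg.2 θ.2.2)
  have := mul_le_mul_of_nonneg_left h2 θ.2.1
  calc _ ≤ (1 - (θ : ℝ)) * (1 / S * x) + θ * 1 := by linarith
    _ = _ := by ring

theorem cdfLE_mix_uniform (θ : Set.Icc (0 : ℝ) 1) {s S : ℝ} (hs : 0 < s) (hS : 0 < S) :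
    CdfLE (mix θ (uniformLaw S) (uniformLaw s)) 0 (θ / s + (1 - θ) / S) := fun x => by
  rw [mix_real]
  have := mul_le_mul_of_nonneg_left (uniformLaw_Iic_le hS x) (sub_nonneg.2 θ.2.2)
  have := mul_le_mul_of_nonneg_left (uniformLaw_Iic_le hs x) θ.2.1
  calc _ ≤ (1 - (θ : ℝ)) * (1 / S * x) + θ * (1 / s * x) := by linarith
    _ = _ := by ring

/-- Below the top of its support this law attains the affine bound of `cdfLE_mix`, and above it the
constant bound 1. Hence a sure amount is a best reply to it. -/
theorem min_le_mix_zero_Iic (θ : Set.Icc (0 : ℝ) 1) {S : ℝ} (hS : 0 < S) (x : ℝ≥0) :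
    min 1 (θ + (1 - θ) / S * x) ≤
      (mix θ (uniformLaw S) (uniformLaw 0) : Measure ℝ≥0).real (Set.Iic x) := by
  rw [mix_real, uniformLaw_zero_Iic]
  have h := le_mul_uniformLaw_Iic hS.le x
  have hθ : 0 ≤ 1 - (θ : ℝ) := sub_nonneg.2 θ.2.2
  rcases min_le_iff.1 h with h | h
  · have h1 : 1 ≤ (uniformLaw S : Measure ℝ≥0).real (Set.Iic x) := by
      rwa [← mul_le_mul_iff_right₀ hS, mul_one]
    refine (min_le_left _ _).trans ?_
    nlinarith
  · refine (min_le_right _ _).trans ?_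
    have h1 : 1 / S * x ≤ (uniformLaw S : Measure ℝ≥0).real (Set.Iic x) := by
      rw [one_div_mul_eq_div, div_le_iff₀ hS]; linarith
    have := mul_le_mul_of_nonneg_left h1 hθ
    calc (θ : ℝ) + (1 - θ) / S * x = (1 - (θ : ℝ)) * (1 / S * x) + θ * 1 := by ring
      _ ≤ _ := by linarith

theorem utilB_eq (v : Fin n → ℝ) (μ : ℝ) (S : Profile n) :
    utilB v μ S = totalValue v - (μ * utilA v S .high + (1 - μ) * utilA v S .low) := by
  unfold utilB utilA payoffB
  ring

/-- Sufficient conditions for proportional allocations to form an equilibrium: both players have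
affine guarantees that add up to the total value. -/
theorem isBNE_proportional (hn : 0 < n) (hv : ∀ j, 0 < v j) {Ah Al μ B α β ah bh al bl : ℝ}
    {Fh Fl G : ProbabilityMeasure ℝ≥0} (hAl : 0 < Al) (hAh : Al ≤ Ah) (hμ0 : 0 ≤ μ) (hμ1 : μ ≤ 1)
    (hB : 0 ≤ B) (hα : 0 ≤ α) (hβ : 0 ≤ β) (hah : 0 ≤ ah) (hbh : 0 ≤ bh) (hal : 0 ≤ al)
    (hbl : 0 ≤ bl) (hF : Guarantee Ah Al μ α β Fh Fl) (hG : MeanLE G B) (hGh : CdfLE G ah bh)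
    (hGl : CdfLE G al bl)
    (hsum : μ * (ah + bh * Ah) + (1 - μ) * (al + bl * Al) + (α + β * B) ≤ 1)
    (hh : μ = 0 → totalValue v * (ah + bh * Ah) ≤
      payoffA v (proportional v Fh) (proportional v G))
    (hl : μ = 1 → totalValue v * (al + bl * Al) ≤
      payoffA v (proportional v Fl) (proportional v G)) :
    IsBNE v Ah Al μ B
      ⟨fun t => match t with
        | .high => proportional v Fh
        | .low => proportional v Fl, proportional v G⟩ := by
  have hφ := totalValue_pos hn hv
  have hAh0 : 0 ≤ Ah := hAl.le.trans hAh
  have feasG := proportional_mem_feasible hn hv hG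
  have feash := proportional_mem_feasible hn hv hF.1
  have feasl := proportional_mem_feasible hn hv hF.2.1
  have bh' := fun (F : Mixed n) (h : F ∈ feasible n Ah) =>
    payoffA_proportional_le hn hv hAh0 hah hbh h hGh
  have bl' := fun (F : Mixed n) (h : F ∈ feasible n Al) =>
    payoffA_proportional_le hn hv hAl.le hal hbl h hGl
  have bB := fun (F : Mixed n) (h : F ∈ feasible n B) =>
    utilB_proportional_le hn hv hB hα hβ hμ0 hμ1 h hF.2.2
  have e1 := bh' _ feash
  have e2 := bl' _ feasl
  have e3 := bB _ feasG
  have id1 : μ * payoffB v (proportional v Fh) (proportional v G) +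
      (1 - μ) * payoffB v (proportional v Fl) (proportional v G) = totalValue v -
      (μ * payoffA v (proportional v Fh) (proportional v G) +
      (1 - μ) * payoffA v (proportional v Fl) (proportional v G)) := by
    unfold payoffB; ring
  have e1' := mul_le_mul_of_nonneg_left e1 hμ0
  have e2' := mul_le_mul_of_nonneg_left e2 (sub_nonneg.2 hμ1)
  have hsum' := mul_le_mul_of_nonneg_left hsum hφ.le
  refine ⟨?_, feasG, ?_, ?_⟩
  · rintro (_ | _)
    · exact feash
    · exact feasl
  · rintro (_ | _) F hF'
    · refine (bh' F hF').trans ?_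
      show _ ≤ payoffA v (proportional v Fh) (proportional v G)
      -- The payoffs add up to the total value and the upper bounds add up to no more, so each bound
      -- carrying positive weight is attained. A type of probability zero escapes this argument,
      -- whence `hh` and `hl`.
      rcases hμ0.eq_or_lt with h | h
      · exact hh h.symm
      · rw [← mul_le_mul_iff_right₀ h]
        linarith
    · refine (bl' F hF').trans ?_
      show _ ≤ payoffA v (proportional v Fl) (proportional v G)
      rcases hμ1.eq_or_lt with h | h
      · exact hl h
      · rw [← mul_le_mul_iff_right₀ (sub_pos.2 h)]
        linarith
  · intro F hF'
    refine (bB F hF').trans ?_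
    show _ ≤ μ * payoffB v (proportional v Fh) (proportional v G) +
      (1 - μ) * payoffB v (proportional v Fl) (proportional v G)
    linarith

/-- With β = x²/2 the two quadratic budget conditions become linear in x: α must dominate 1 - Px and
1 - μ - Rx. -/
theorem exists_guarantee_of_sqrt {Ah Al μ α x P R : ℝ} (hAl : 0 < Al) (hAh : Al ≤ Ah) (hμ0 : 0 ≤ μ)
    (hμ1 : μ ≤ 1) (hα0 : 0 ≤ α) (hα1 : α ≤ 1) (hx : 0 < x) (hR : 0 ≤ R)
    (hP2 : P ^ 2 = meanBudget Ah Al μ) (hR2 : R ^ 2 = (1 - μ) * Al)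
    (hall : 1 - α ≤ P * x) (hlow : 1 - μ - α ≤ R * x) :
    ∃ Fh Fl, Guarantee Ah Al μ α (x ^ 2 / 2) Fh Fl := by
  refine exists_guarantee hAl hAh hμ0 hμ1 hα0 hα1 (by positivity) ?_ ?_
  · calc (1 - α) ^ 2 ≤ (P * x) ^ 2 := pow_le_pow_left₀ (by linarith) hall 2
      _ = _ := by rw [mul_pow, hP2]; ring
  · calc max (1 - μ - α) 0 ^ 2 ≤ (R * x) ^ 2 :=
        pow_le_pow_left₀ (le_max_right _ _) (max_le hlow (by positivity)) 2
      _ = _ := by rw [mul_pow, hR2]; ring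

theorem meanLE_dirac (a : ℝ) :
    MeanLE ⟨Measure.dirac a.toNNReal, inferInstance⟩ a := by
  show ∫⁻ x, (x : ℝ≥0∞) ∂(Measure.dirac a.toNNReal) ≤ _
  rw [lintegral_dirac' _ (by fun_prop)]
  rfl

/-- A sure amount equal to the budget is a best reply to a uniform law with an atom at zero. -/
theorem exists_affine_of_dirac (hn : 0 < n) (hv : ∀ j, 0 < v j) (θ : Set.Icc (0 : ℝ) 1) {S a : ℝ}
    (hS : 0 < S) (ha : 0 ≤ a) :
    ∃ c d : ℝ, 0 ≤ c ∧ 0 ≤ d ∧ CdfLE (mix θ (uniformLaw S) (uniformLaw 0)) c d ∧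
      totalValue v * (c + d * a) ≤
        payoffA v (proportional v ⟨Measure.dirac a.toNNReal, inferInstance⟩)
          (proportional v (mix θ (uniformLaw S) (uniformLaw 0))) := by
  have h1 := le_payoffA_dirac hn hv (G := mix θ (uniformLaw S) (uniformLaw 0)) (x := a.toNNReal)
    (F := ⟨Measure.dirac a.toNNReal, inferInstance⟩) rfl
  have h2 := min_le_mix_zero_Iic θ hS a.toNNReal
  rw [Real.coe_toNNReal _ ha] at h2
  have hφ := totalValue_pos hn hv
  rcases min_le_iff.1 h2 with h | h
  · refine ⟨1, 0, zero_le_one, le_rfl, cdfLE_one _, le_trans ?_ h1⟩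
    exact mul_le_mul_of_nonneg_left (by linarith) hφ.le
  · exact ⟨θ, (1 - θ) / S, θ.2.1, div_nonneg (sub_nonneg.2 θ.2.2) hS.le, cdfLE_mix θ hS _,
      le_trans (mul_le_mul_of_nonneg_left h hφ.le) h1⟩

/-- Here one affine bound on B's law serves both types. If the belief is degenerate, the impossible
type is given its whole budget as a sure amount, which is a best reply by `exists_affine_of_dirac`.
-/
theorem exists_isBNE_of_common (hn : 0 < n) (hv : ∀ j, 0 < v j) {Ah Al μ B α β S : ℝ}
    (θ : Set.Icc (0 : ℝ) 1)
    (hAl : 0 < Al) (hAh : Al ≤ Ah) (hμ0 : 0 ≤ μ) (hμ1 : μ ≤ 1)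
    (hB : 0 ≤ B) (hα : 0 ≤ α) (hβ : 0 ≤ β) (hS : 0 < S)
    (hF : ∃ Fh Fl, Guarantee Ah Al μ α β Fh Fl) (hG : (1 - θ) * (S / 2) ≤ B)
    (hsum : θ + (1 - θ) / S * meanBudget Ah Al μ + (α + β * B) ≤ 1) :
    ∃ E, IsBNE v Ah Al μ B E := by
  obtain ⟨Fh, Fl, h1, h2, h3⟩ := hF
  have hG' : MeanLE (mix θ (uniformLaw S) (uniformLaw 0)) B :=
    meanLE_mix (by positivity) le_rfl (meanLE_uniformLaw hS.le)
      (by simpa using meanLE_uniformLaw le_rfl) (by linarith)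
  have hcdf := cdfLE_mix θ hS (uniformLaw 0)
  have hθ0 : (0 : ℝ) ≤ θ := θ.2.1
  have hd : 0 ≤ (1 - (θ : ℝ)) / S := div_nonneg (sub_nonneg.2 θ.2.2) hS.le
  have hAh0 : 0 ≤ Ah := hAl.le.trans hAh
  unfold meanBudget at hsum
  rcases hμ0.eq_or_lt with rfl | h0
  · obtain ⟨c, d, hc, hd', hcd, hle⟩ := exists_affine_of_dirac hn hv θ hS hAh0
    exact ⟨_, isBNE_proportional hn hv hAl hAh hμ0 hμ1 hB hα hβ hc hd' hθ0 hd
      ⟨meanLE_dirac Ah, h2, by simpa using h3⟩ hG' hcd hcdf (by linarith) (fun _ => hle)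
      (fun h => absurd h (by norm_num))⟩
  rcases hμ1.eq_or_lt with rfl | h1'
  · obtain ⟨c, d, hc, hd', hcd, hle⟩ := exists_affine_of_dirac hn hv θ hS hAl.le
    exact ⟨_, isBNE_proportional hn hv hAl hAh hμ0 hμ1 hB hα hβ hθ0 hd hc hd'
      ⟨h1, meanLE_dirac Al, by simpa using h3⟩ hG' hcdf hcd (by linarith)
      (fun h => absurd h (by norm_num)) (fun _ => hle)⟩
  · exact ⟨_, isBNE_proportional hn hv hAl hAh hμ0 hμ1 hB hα hβ hθ0 hd hθ0 hd ⟨h1, h2, h3⟩ hG'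
      hcdf hcdf (by linarith) (fun h => absurd h h0.ne') (fun h => absurd h h1'.ne)⟩

/-- B's value is the lower envelope over x of max(0, 1 - Px, 1 - μ - Rx) + x²B/2. The cases record
where the minimum over x lies: on a smooth piece, at a zero of the maximum, or at the crossing of
the two lines. -/
theorem exists_isBNE (hn : 0 < n) (hv : ∀ j, 0 < v j) {Ah Al μ B : ℝ}
    (hAl : 0 < Al) (hAh : Al ≤ Ah) (hμ0 : 0 ≤ μ) (hμ1 : μ ≤ 1) (hB : 0 ≤ B) :
    ∃ E, IsBNE v Ah Al μ B E := by
  have hAh0 : 0 < Ah := hAl.trans_le hAh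
  have hM : 0 < meanBudget Ah Al μ := by unfold meanBudget; nlinarith
  obtain ⟨P, hP, hP2⟩ : ∃ P : ℝ, 0 < P ∧ P ^ 2 = meanBudget Ah Al μ :=
    ⟨√(meanBudget Ah Al μ), Real.sqrt_pos.2 hM, Real.sq_sqrt hM.le⟩
  obtain ⟨R, hR, hR2⟩ : ∃ R : ℝ, 0 ≤ R ∧ R ^ 2 = (1 - μ) * Al :=
    ⟨√((1 - μ) * Al), Real.sqrt_nonneg _, Real.sq_sqrt (mul_nonneg (by linarith) hAl.le)⟩
  have hsub : P ^ 2 - R ^ 2 = μ * Ah := by rw [hP2, hR2]; unfold meanBudget; ring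
  have hRP : R ≤ P := by
    refine le_of_sq_le_sq ?_ hP.le
    nlinarith
  -- every type is active on the whole range of bids
  have large : ∀ B, 0 < B → P ^ 2 ≤ B → (P - R) * P ≤ μ * B → ∃ E, IsBNE v Ah Al μ B E := by
    intro B hB hPB hμB
    have hα : 0 ≤ 1 - P ^ 2 / B := sub_nonneg.2 ((div_le_one hB).2 hPB)
    refine exists_isBNE_of_common hn hv (S := 2 * B) ⟨0, by norm_num⟩ hAl hAh hμ0 hμ1 hB.le hα
      (β := (P / B) ^ 2 / 2) (by positivity) (by positivity)
      (exists_guarantee_of_sqrt hAl hAh hμ0 hμ1 hα (by linarith [show 0 ≤ P ^ 2 / B by positivity])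
        (by positivity) hR hP2 hR2 (le_of_eq (by ring)) ?_) ?_ ?_
    · have : (P - R) * P / B ≤ μ := (div_le_iff₀ hB).2 hμB
      have e : (P - R) * P / B = P ^ 2 / B - R * (P / B) := by ring
      linarith
    · simp
    · rw [← hP2]
      refine le_of_eq ?_
      field_simp
      ring
  by_cases hcase : (1 - μ) * P ≤ R
  · rcases le_or_gt B (P ^ 2) with hBP | hBP
    · have h1 : B / P ^ 2 ≤ 1 := (div_le_one (by positivity)).2 hBP
      have h0 : 0 ≤ B / P ^ 2 := by positivity
      -- The minimum sits at the zero x = 1/P; B lacks the means for the uniform law of mean P² and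
      -- puts the remaining mass at zero.
      refine exists_isBNE_of_common hn hv (S := 2 * P ^ 2) ⟨1 - B / P ^ 2, by linarith, by linarith⟩
        hAl hAh hμ0 hμ1 hB le_rfl
        (β := (1 / P) ^ 2 / 2) (by positivity) (by positivity)
        (exists_guarantee_of_sqrt hAl hAh hμ0 hμ1 le_rfl zero_le_one
          (by positivity) hR hP2 hR2 (le_of_eq (by field_simp; ring)) ?_) ?_ ?_
      · rw [mul_one_div, le_div_iff₀ hP]
        linarith
      · simp only [sub_sub_cancel]
        refine le_of_eq ?_
        field_simp
      · simp only [sub_sub_cancel]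
        rw [← hP2]
        refine le_of_eq ?_
        field_simp
        ring
    · exact large B (by nlinarith) hBP.le (by nlinarith)
  · push Not at hcase
    have hμpos : 0 < μ := by
      rcases hμ0.eq_or_lt with rfl | h
      · exfalso
        have : P ^ 2 = R ^ 2 := by linarith
        have : P ≤ R := le_of_sq_le_sq this.le hR
        linarith
      · exact h
    have hν : 0 < 1 - μ := by
      rcases hμ1.eq_or_lt with rfl | h
      · simp at hcase; linarith
      · linarith
    have hRpos : 0 < R := by
      rcases hR.eq_or_lt with rfl | h
      · have : 0 < (1 - μ) * Al := by positivity
        nlinarith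
      · exact h
    have hPR : 0 < P - R := by nlinarith
    have hμlt : μ * P < P - R := by linarith
    rcases le_or_gt B Al with hBA | hBA
    · -- player B is too weak to contest with certainty even the low type
      have h1 : B / Al ≤ 1 := (div_le_one (by positivity)).2 hBA
      have h0 : 0 ≤ B / Al := by positivity
      -- The slope parameter is the zero of 1 - μ - Rx. The high type is conceded through the
      -- trivial bound `cdfLE_one`.
      obtain ⟨Fh, Fl, hF⟩ := exists_guarantee_of_sqrt (α := 0) (x := (1 - μ) / R) hAl hAh hμ0 hμ1
        le_rfl zero_le_one (by positivity) hR hP2 hR2 (by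
          rw [mul_div_assoc', le_div_iff₀ hRpos]; linarith) (le_of_eq (by field_simp; ring))
      have hθ : 1 - B / Al ∈ Set.Icc (0 : ℝ) 1 := ⟨by linarith, by linarith⟩
      have hc := cdfLE_mix ⟨_, hθ⟩ (S := 2 * Al) (by positivity) (uniformLaw 0)
      simp only [sub_sub_cancel] at hc
      refine ⟨_, isBNE_proportional hn hv hAl hAh hμ0 hμ1 hB le_rfl (by positivity) zero_le_one
        le_rfl hθ.1 (by positivity) hF
        (meanLE_mix (A := Al) (A' := 0) hAl.le le_rfl
          (by simpa using meanLE_uniformLaw (s := 2 * Al) (by positivity))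
          (by simpa using meanLE_uniformLaw le_rfl) ?_) (cdfLE_one _) hc ?_ (fun h => absurd h hμpos.ne')
          (fun h => absurd h (by linarith))⟩
      · simp only [sub_sub_cancel]
        refine le_of_eq ?_
        field_simp
        ring
      · rw [div_pow, hR2]
        refine le_of_eq ?_
        field_simp
        ring
    have hB0 : 0 < B := hAl.trans hBA
    rcases le_or_gt (μ * B) ((P - R) * R) with hB1 | hB1
    · -- player B contests the low type only
      have hα : 0 ≤ (1 - μ) - R ^ 2 / B := by
        rw [hR2, mul_div_assoc]
        have : Al / B ≤ 1 := (div_le_one hB0).2 hBA.le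
        nlinarith
      obtain ⟨Fh, Fl, hF⟩ := exists_guarantee_of_sqrt (x := R / B) hAl hAh hμ0 hμ1 hα
        (by linarith [show 0 ≤ R ^ 2 / B by positivity]) (by positivity) hR hP2 hR2 (by
          have : μ ≤ (P - R) * R / B := (le_div_iff₀ hB0).2 hB1
          have e : (P - R) * R / B = P * (R / B) - R ^ 2 / B := by ring
          linarith) (le_of_eq (by ring))
      have hc := cdfLE_uniformLaw (s := 2 * B) (by positivity)
      refine ⟨_, isBNE_proportional hn hv hAl hAh hμ0 hμ1 hB hα (by positivity) zero_le_one
        le_rfl le_rfl (by positivity) hF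
        (by simpa using meanLE_uniformLaw (s := 2 * B) (by positivity)) (cdfLE_one _)
        hc ?_ (fun h => absurd h hμpos.ne')
          (fun h => absurd h (by linarith))⟩
      rw [div_pow, hR2]
      refine le_of_eq ?_
      field_simp
      ring
    rcases le_or_gt ((P - R) * P) (μ * B) with hB2 | hB2
    · refine large B hB0 ?_ hB2
      by_contra! hlt
      nlinarith
    · -- the two types bid on disjoint intervals that are both contested
      obtain ⟨x, hx, hxe⟩ : ∃ x : ℝ, 0 < x ∧ x * (P - R) = μ :=
        ⟨μ / (P - R), by positivity, div_mul_cancel₀ _ hPR.ne'⟩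
      have hα : 0 ≤ 1 - P * x := by
        have : (P * x) * (P - R) ≤ 1 * (P - R) := by nlinarith
        linarith [le_of_mul_le_mul_right this hPR]
      obtain ⟨Fh, Fl, hF⟩ := exists_guarantee_of_sqrt (x := x) hAl hAh hμ0 hμ1 hα
        (by linarith [show 0 ≤ P * x by positivity]) (by positivity) hR hP2 hR2 (le_of_eq (by ring))
        (by linarith)
      have hd : P / x - R / x = (P - R) / x := by ring
      have hdpos : 0 < (P - R) / x := by positivity
      have hRB : R / x ≤ B := by
        rw [div_le_iff₀ hx]
        refine le_of_mul_le_mul_left ?_ hPR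
        rw [← hxe] at hB1
        linarith
      have hBP : B ≤ P / x := by
        rw [le_div_iff₀ hx]
        refine le_of_mul_le_mul_left ?_ hPR
        rw [← hxe] at hB2
        linarith
      -- At the crossing B mixes two uniform laws with means R/x and P/x, weighted to have mean B.
      -- The shorter one is conceded to the high type.
      have hθ : (P / x - B) / ((P - R) / x) ∈ Set.Icc (0 : ℝ) 1 :=
        ⟨div_nonneg (by linarith) hdpos.le, (div_le_one hdpos).2 (by linarith)⟩
      obtain ⟨θ, hθe⟩ : ∃ θ : Set.Icc (0 : ℝ) 1, (θ : ℝ) * ((P - R) / x) = P / x - B :=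
        ⟨⟨_, hθ⟩, div_mul_cancel₀ _ hdpos.ne'⟩
      have hθ0 : (0 : ℝ) ≤ θ := θ.2.1
      have hθ1 : (0 : ℝ) ≤ 1 - θ := sub_nonneg.2 θ.2.2
      have hBe : B = θ * (R / x) + (1 - θ) * (P / x) := by linear_combination hθe
      have hs : 0 < 2 * (R / x) := by positivity
      have hS : 0 < 2 * (P / x) := by positivity
      have hc := cdfLE_mix θ hS (uniformLaw (2 * (R / x)))
      have hc' := cdfLE_mix_uniform θ hs hS
      have hmR : MeanLE (uniformLaw (2 * (R / x))) (R / x) := by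
        convert meanLE_uniformLaw hs.le using 1; ring
      have hmP : MeanLE (uniformLaw (2 * (P / x))) (P / x) := by
        convert meanLE_uniformLaw hS.le using 1; ring
      refine ⟨_, isBNE_proportional hn hv hAl hAh hμ0 hμ1 hB hα (by positivity) hθ0
        (by positivity) le_rfl (by positivity) hF
        (meanLE_mix (by positivity) (by positivity) hmP hmR (le_of_eq (by rw [hBe]; ring)))
        hc hc' ?_ (fun h => absurd h hμpos.ne')
          (fun h => absurd h (by linarith))⟩
      have eR : (θ : ℝ) / (2 * (R / x)) * ((1 - μ) * Al) = θ * R * x / 2 := by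
        rw [← hR2]; field_simp
      have eP : (1 - (θ : ℝ)) / (2 * (P / x)) * (P ^ 2) = (1 - θ) * P * x / 2 := by
        field_simp
      have eB : x ^ 2 / 2 * B = θ * R * x / 2 + (1 - θ) * P * x / 2 := by
        rw [hBe]; field_simp
      rw [hP2] at eP
      unfold meanBudget at eP
      refine le_of_eq ?_
      linear_combination eR + eP + eB - θ * hxe

theorem exists_isEquilibriumSelection (hn : 0 < n) (hv : ∀ j, 0 < v j) {Ah Al : ℝ}
    (hAl : 0 < Al) (hAh : Al ≤ Ah) : ∃ E : ℝ → ℝ → Profile n, IsEquilibriumSelection v Ah Al E := by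
  classical
  have : ∀ μ B, ∃ S, μ ∈ Set.Icc (0 : ℝ) 1 → 0 ≤ B → IsBNE v Ah Al μ B S := by
    intro μ B
    by_cases h : μ ∈ Set.Icc (0 : ℝ) 1 ∧ 0 ≤ B
    · obtain ⟨S, hS⟩ := exists_isBNE hn hv hAl hAh h.1.1 h.1.2 h.2
      exact ⟨S, fun _ _ => hS⟩
    · obtain ⟨S, -⟩ := exists_isBNE (μ := 0) (B := 0) hn hv hAl hAh le_rfl zero_le_one le_rfl
      exact ⟨S, fun h1 h2 => absurd ⟨h1, h2⟩ h⟩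
  choose E hE using this
  exact ⟨E, fun μ hμ B hB => hE μ B hμ hB⟩

/-- Each type may deviate to its part of the guarantee, so its equilibrium payoff is no smaller than
what the guarantee secures against B's actual allocation. -/
theorem IsBNE.utilB_le (hn : 0 < n) (hv : ∀ j, 0 < v j) {Ah Al μ B α β : ℝ} {S : Profile n}
    (hS : IsBNE v Ah Al μ B S) (hμ0 : 0 ≤ μ) (hμ1 : μ ≤ 1)
    (hB : 0 ≤ B) (hα : 0 ≤ α) (hβ : 0 ≤ β) (hF : ∃ Fh Fl, Guarantee Ah Al μ α β Fh Fl) :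
    utilB v μ S ≤ totalValue v * (α + β * B) := by
  obtain ⟨Fh, Fl, h1, h2, h3⟩ := hF
  have e1 := mul_le_mul_of_nonneg_left
    (hS.optimalA .high _ (proportional_mem_feasible hn hv h1)) hμ0
  have e2 := mul_le_mul_of_nonneg_left
    (hS.optimalA .low _ (proportional_mem_feasible hn hv h2)) (sub_nonneg.2 hμ1)
  have e3 := utilB_proportional_le hn hv hB hα hβ hμ0 hμ1 hS.feasibleB h3
  rw [utilB_eq]
  unfold payoffB at e3
  linarith

/-- The mirror image: B may deviate to the proportional allocation with total law `G`, with a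
separate affine bound for each type. -/
theorem IsBNE.le_utilB (hn : 0 < n) (hv : ∀ j, 0 < v j) {Ah Al μ B ah bh al bl : ℝ} {S : Profile n}
    {G : ProbabilityMeasure ℝ≥0} (hAl : 0 < Al) (hAh : Al ≤ Ah)
    (hS : IsBNE v Ah Al μ B S) (hμ0 : 0 ≤ μ) (hμ1 : μ ≤ 1) (hah : 0 ≤ ah) (hbh : 0 ≤ bh)
    (hal : 0 ≤ al) (hbl : 0 ≤ bl) (hG : MeanLE G B) (hGh : CdfLE G ah bh) (hGl : CdfLE G al bl) :
    totalValue v * (1 - (μ * (ah + bh * Ah) + (1 - μ) * (al + bl * Al))) ≤ utilB v μ S := by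
  have e := hS.optimalB _ (proportional_mem_feasible hn hv hG)
  rw [utilB_eq] at e
  have e1 := mul_le_mul_of_nonneg_left (payoffA_proportional_le hn hv (hAl.le.trans hAh) hah hbh
    (hS.feasibleA .high) hGh) hμ0
  have e2 := mul_le_mul_of_nonneg_left (payoffA_proportional_le hn hv hAl.le hal hbl
    (hS.feasibleA .low) hGl) (sub_nonneg.2 hμ1)
  unfold utilA at e
  simp only at e
  linarith

end Equilibria

/-! ### Player B's optimal investment -/

section Investment

variable {n : ℕ} {v : Fin n → ℝ}

/-- If a payoff lies below a family of affine functions and touches one of them, then the point of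
contact is the least optimal investment. -/
theorem least_investment_of_envelope {f : ℝ → ℝ} {C K x₀ x₁ : ℝ} (hx₀ : 0 < x₀) (hx₁ : x₀ < x₁)
    (hK : 0 < K)
    (hle : ∀ x, x₀ ≤ x → x < x₁ → ∀ B, 0 ≤ B → f B ≤ C - K * x + x ^ 2 / 2 * B)
    (hge : C - K * x₀ / 2 ≤ f (K / x₀)) :
    (∀ B, 0 ≤ B → f B - x₀ ^ 2 / 2 * B ≤ f (K / x₀) - x₀ ^ 2 / 2 * (K / x₀)) ∧
      f (K / x₀) = C - K * x₀ / 2 ∧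
      ∀ B, 0 ≤ B → (∀ B', 0 ≤ B' → f B' - x₀ ^ 2 / 2 * B' ≤ f B - x₀ ^ 2 / 2 * B) →
        K / x₀ ≤ B := by
  have e : x₀ ^ 2 / 2 * (K / x₀) = K * x₀ / 2 := by field_simp
  have hB₀ : 0 < K / x₀ := by positivity
  refine ⟨fun B hB => ?_, ?_, fun B hB hopt => ?_⟩
  · linarith [hle x₀ le_rfl hx₁ B hB]
  · linarith [hle x₀ le_rfl hx₁ _ hB₀.le]
  · rw [div_le_iff₀ hx₀]
    by_contra! hlt
    have h1 := hopt _ hB₀.le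
    -- For B < K/x₀ the bound C - Kx + x²B/2 is still decreasing in x at x₀, so a slightly larger x
    -- gives a strictly better bound; δ stays below x₁ - x₀ and within that descent.
    set δ := min ((x₁ - x₀) / 2) ((K - B * x₀) / (B + 1)) with hδ
    have hδ0 : 0 < δ := lt_min (by linarith) (div_pos (by linarith) (by linarith))
    have hδ1 : δ ≤ (x₁ - x₀) / 2 := min_le_left _ _
    have hδ2 : δ * (B + 1) ≤ K - B * x₀ :=
      (le_div_iff₀ (by linarith)).1 (min_le_right _ _)
    have h2 := hle (x₀ + δ) (by linarith) (by linarith) B hB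
    have h3 : δ * K ≤ δ * ((x₀ + δ / 2) * B) := by nlinarith
    have h4 := le_of_mul_le_mul_left h3 hδ0
    nlinarith

theorem meanBudget_pos {Ah Al μ : ℝ} (hAl : 0 < Al) (hAh : Al ≤ Ah) (hμ0 : 0 ≤ μ) :
    0 < meanBudget Ah Al μ := by
  unfold meanBudget; nlinarith

theorem sqrt_lowBudget_le {Ah Al μ : ℝ} (hAl : 0 < Al) (hAh : Al ≤ Ah) (hμ0 : 0 ≤ μ) :
    √((1 - μ) * Al) ≤ √(meanBudget Ah Al μ) := by
  refine Real.sqrt_le_sqrt ?_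
  unfold meanBudget; nlinarith

theorem sq_sqrt_sub_sq_sqrt {Ah Al μ : ℝ} (hAl : 0 < Al) (hAh : Al ≤ Ah) (hμ0 : 0 ≤ μ)
    (hμ1 : μ ≤ 1) :
    (√(meanBudget Ah Al μ) - √((1 - μ) * Al)) * (√((1 - μ) * Al) + √(meanBudget Ah Al μ)) =
      μ * Ah := by
  have h1 := Real.sq_sqrt (meanBudget_pos hAl hAh hμ0).le
  have h2 := Real.sq_sqrt (mul_nonneg (sub_nonneg.2 hμ1) hAl.le)
  have h3 : meanBudget Ah Al μ = μ * Ah + (1 - μ) * Al := rfl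
  linear_combination h1 - h2 + h3

/-- The threshold equals ((R + P)/A_h)²/2, so the comparison with x²/2 is one of positive square
roots. -/
theorem lam_le_iff {Ah Al μ x : ℝ} (hAh : 0 < Ah) (hx : 0 ≤ x) :
    lam 1 Ah Al μ ≤ x ^ 2 / 2 ↔ √((1 - μ) * Al) + √(meanBudget Ah Al μ) ≤ x * Ah := by
  have e : lam 1 Ah Al μ = ((√((1 - μ) * Al) + √(meanBudget Ah Al μ)) / Ah) ^ 2 / 2 := by
    unfold lam meanBudget
    field_simp
  rw [e, div_le_div_iff_of_pos_right two_pos, sq_le_sq₀ (by positivity) hx, div_le_iff₀ hAh]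

theorem lt_lam_iff {Ah Al μ x : ℝ} (hAh : 0 < Ah) (hx : 0 ≤ x) :
    x ^ 2 / 2 < lam 1 Ah Al μ ↔ x * Ah < √((1 - μ) * Al) + √(meanBudget Ah Al μ) := by
  rw [← not_le, lam_le_iff hAh hx, not_le]

theorem sub_mul_le_of_mul_le {Ah Al μ x : ℝ} (hAl : 0 < Al) (hAh : Al ≤ Ah) (hμ0 : 0 ≤ μ)
    (hμ1 : μ ≤ 1) (h : x * Ah ≤ √((1 - μ) * Al) + √(meanBudget Ah Al μ)) :
    (√(meanBudget Ah Al μ) - √((1 - μ) * Al)) * x ≤ μ := by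
  have h1 := sq_sqrt_sub_sq_sqrt hAl hAh hμ0 hμ1
  have h2 := mul_le_mul_of_nonneg_left h (sub_nonneg.2 (sqrt_lowBudget_le hAl hAh hμ0))
  refine le_of_mul_le_mul_right ?_ (hAl.trans_le hAh)
  linarith

theorem le_sub_mul_of_le_mul {Ah Al μ x : ℝ} (hAl : 0 < Al) (hAh : Al ≤ Ah) (hμ0 : 0 ≤ μ)
    (hμ1 : μ ≤ 1) (h : √((1 - μ) * Al) + √(meanBudget Ah Al μ) ≤ x * Ah) :
    μ ≤ (√(meanBudget Ah Al μ) - √((1 - μ) * Al)) * x := by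
  have h1 := sq_sqrt_sub_sq_sqrt hAl hAh hμ0 hμ1
  have h2 := mul_le_mul_of_nonneg_left h (sub_nonneg.2 (sqrt_lowBudget_le hAl hAh hμ0))
  refine le_of_mul_le_mul_right ?_ (hAl.trans_le hAh)
  linarith

/-- Under the belief `μ`, player B contests both types. -/
def ContestsBoth (Ah Al κ μ : ℝ) : Prop :=
  2 * κ * meanBudget Ah Al μ < 1 ∧ κ < lam 1 Ah Al μ

/-- Under the belief `μ`, player B contests the low type only. -/
def ContestsLow (Ah Al κ μ : ℝ) : Prop :=
  lam 1 Ah Al μ ≤ κ ∧ 2 * κ * Al < 1 - μ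

theorem exists_sqrt_two_mul {κ : ℝ} (hκ : 0 < κ) : ∃ x : ℝ, 0 < x ∧ κ = x ^ 2 / 2 := by
  refine ⟨√(2 * κ), by positivity, ?_⟩
  rw [Real.sq_sqrt (by positivity)]; ring

/-- Where player B contests neither type, investing is too costly against the average budget and
against the low one. -/
theorem not_contests_iff {Ah Al κ μ : ℝ} (hAl : 0 < Al) (hAh : Al ≤ Ah) (hκ : 0 < κ) (hμ0 : 0 ≤ μ) (hμ1 : μ ≤ 1) :
    (¬ ContestsBoth Ah Al κ μ ∧ ¬ ContestsLow Ah Al κ μ) ↔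
      1 ≤ 2 * κ * meanBudget Ah Al μ ∧ 1 - μ ≤ 2 * κ * Al := by
  have hAh0 : 0 < Ah := hAl.trans_le hAh
  have hν : 0 ≤ 1 - μ := sub_nonneg.2 hμ1
  have hM := meanBudget_pos hAl hAh hμ0
  obtain ⟨x, hx, hx2⟩ := exists_sqrt_two_mul hκ
  have hlam := lam_le_iff (Al := Al) (μ := μ) hAh0 hx.le
  have hlam' := lt_lam_iff (Al := Al) (μ := μ) hAh0 hx.le
  rw [← hx2] at hlam hlam'
  have hP2 := Real.sq_sqrt hM.le
  have hR2 := Real.sq_sqrt (mul_nonneg hν hAl.le)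
  have hP : 0 ≤ √(meanBudget Ah Al μ) := Real.sqrt_nonneg _
  have hR : 0 ≤ √((1 - μ) * Al) := Real.sqrt_nonneg _
  have hx2' : x ^ 2 = 2 * κ := by rw [hx2]; ring
  constructor
  · rintro ⟨hcM, hcL⟩
    -- The position relative to the threshold tells which of the two lines is higher. The failed
    -- contest makes that line nonpositive, and the other lies below it.
    rcases le_or_gt (lam 1 Ah Al μ) κ with h | h
    · have h1 := le_sub_mul_of_le_mul hAl hAh hμ0 hμ1 (hlam.1 h)
      have h2 : 1 - μ ≤ 2 * κ * Al := not_lt.1 fun h' => hcL ⟨h, h'⟩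
      have h3 : (1 - μ) ^ 2 ≤ (√((1 - μ) * Al) * x) ^ 2 := by
        rw [mul_pow, hR2, hx2']; nlinarith
      have h4 := (sq_le_sq₀ hν (by positivity)).1 h3
      have h5 : 1 ≤ √(meanBudget Ah Al μ) * x := by linarith
      have h6 := pow_le_pow_left₀ zero_le_one h5 2
      rw [mul_pow, hP2, hx2'] at h6
      exact ⟨by linarith, h2⟩
    · have h1 := sub_mul_le_of_mul_le hAl hAh hμ0 hμ1 (hlam'.1 h).le
      have h2 : 1 ≤ 2 * κ * meanBudget Ah Al μ := not_lt.1 fun h' => hcM ⟨h', h⟩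
      have h3 : 1 ^ 2 ≤ (√(meanBudget Ah Al μ) * x) ^ 2 := by
        rw [mul_pow, hP2, hx2']; linarith
      have h4 := (sq_le_sq₀ zero_le_one (by positivity)).1 h3
      have h5 : 1 - μ ≤ √((1 - μ) * Al) * x := by linarith
      have h6 := pow_le_pow_left₀ hν h5 2
      rw [mul_pow, hR2, hx2'] at h6
      refine ⟨h2, ?_⟩
      rcases hν.eq_or_lt with h7 | h7
      · rw [← h7]; positivity
      · refine le_of_mul_le_mul_left ?_ h7
        linarith
  · rintro ⟨h1, h2⟩
    exact ⟨fun h => absurd h.1 (not_lt.2 h1), fun h => absurd h.2 (not_lt.2 h2)⟩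

/-- Player A's ex-ante payoff, in units of the total value, when B best responds to the belief `μ`
with the least optimal investment at unit cost `κ` (in units of the total value). -/
noncomputable def residual (Ah Al κ μ : ℝ) : ℝ :=
  open Classical in
  if ContestsBoth Ah Al κ μ then √(2 * κ * meanBudget Ah Al μ) / 2
  else if ContestsLow Ah Al κ μ then μ + √(2 * κ * ((1 - μ) * Al)) / 2
  else 1

section Bounds

variable {E : ℝ → ℝ → Profile n} {Ah Al μ : ℝ}

theorem utilB_le_envelope (hn : 0 < n) (hv : ∀ j, 0 < v j) (hAl : 0 < Al) (hAh : Al ≤ Ah)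
    (hE : IsEquilibriumSelection v Ah Al E) (hμ0 : 0 ≤ μ) (hμ1 : μ ≤ 1) {B x α : ℝ} (hB : 0 ≤ B)
    (hx : 0 < x) (hα0 : 0 ≤ α) (hα1 : α ≤ 1) (hall : 1 - α ≤ √(meanBudget Ah Al μ) * x)
    (hlow : 1 - μ - α ≤ √((1 - μ) * Al) * x) :
    utilB v μ (E μ B) / totalValue v ≤ α + x ^ 2 / 2 * B := by
  rw [div_le_iff₀' (totalValue_pos hn hv)]
  exact (hE μ ⟨hμ0, hμ1⟩ B hB).utilB_le hn hv hμ0 hμ1 hB hα0 (by positivity)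
    (exists_guarantee_of_sqrt hAl hAh hμ0 hμ1 hα0 hα1 hx (Real.sqrt_nonneg _)
      (Real.sq_sqrt (meanBudget_pos hAl hAh hμ0).le)
      (Real.sq_sqrt (mul_nonneg (sub_nonneg.2 hμ1) hAl.le)) hall hlow)

/-- B's uniform total on [0, 2B] against both types; at B = P/x it meets the upper envelope. -/
theorem le_utilB_common (hn : 0 < n) (hv : ∀ j, 0 < v j) (hAl : 0 < Al) (hAh : Al ≤ Ah)
    (hE : IsEquilibriumSelection v Ah Al E) (hμ0 : 0 ≤ μ) (hμ1 : μ ≤ 1) {B : ℝ} (hB : 0 < B) :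
    1 - meanBudget Ah Al μ / (2 * B) ≤ utilB v μ (E μ B) / totalValue v := by
  rw [le_div_iff₀' (totalValue_pos hn hv)]
  have hc := cdfLE_uniformLaw (s := 2 * B) (by positivity)
  have h := (hE μ ⟨hμ0, hμ1⟩ B hB.le).le_utilB hn hv hAl hAh hμ0 hμ1 le_rfl (by positivity) le_rfl
    (by positivity) (by simpa using meanLE_uniformLaw (s := 2 * B) (by positivity)) hc hc
  refine le_trans (le_of_eq ?_) h
  unfold meanBudget
  ring

/-- The same uniform total, with the high type conceded; it meets the envelope at B = R/x. -/
theorem le_utilB_low (hn : 0 < n) (hv : ∀ j, 0 < v j) (hAl : 0 < Al) (hAh : Al ≤ Ah)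
    (hE : IsEquilibriumSelection v Ah Al E) (hμ0 : 0 ≤ μ) (hμ1 : μ ≤ 1) {B : ℝ} (hB : 0 < B) :
    1 - μ - (1 - μ) * Al / (2 * B) ≤ utilB v μ (E μ B) / totalValue v := by
  rw [le_div_iff₀' (totalValue_pos hn hv)]
  have hc := cdfLE_uniformLaw (s := 2 * B) (by positivity)
  have h := (hE μ ⟨hμ0, hμ1⟩ B hB.le).le_utilB hn hv hAl hAh hμ0 hμ1 zero_le_one le_rfl le_rfl
    (by positivity) (by simpa using meanLE_uniformLaw (s := 2 * B) (by positivity)) (cdfLE_one _) hc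
  refine le_trans (le_of_eq ?_) h
  ring

theorem mem_optimalInvestments_iff {c : ℝ} (hφ : 0 < totalValue v) (B : ℝ) :
    B ∈ optimalInvestments v c E μ ↔ 0 ≤ B ∧ ∀ B', 0 ≤ B' →
      utilB v μ (E μ B') / totalValue v - c / totalValue v * B' ≤
        utilB v μ (E μ B) / totalValue v - c / totalValue v * B := by
  have h : ∀ B, utilB v μ (E μ B) / totalValue v - c / totalValue v * B =
      (utilB v μ (E μ B) - c * B) / totalValue v := fun B => by ring
  simp only [h, div_le_div_iff_of_pos_right hφ]
  rfl

/-- Subtracting the cost x²B/2 from the envelope leaves max(0, 1 - Px, 1 - μ - Rx) as an upper bound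
on the net payoff. The uniform laws attain a positive maximum at P/x or R/x, and investing nothing
attains zero. Only the ex-ante value is pinned down, which is all that A's expected payoff needs. -/
theorem exists_least_investment (hn : 0 < n) (hv : ∀ j, 0 < v j) (hAl : 0 < Al) (hAh : Al ≤ Ah)
    (hE : IsEquilibriumSelection v Ah Al E) (hμ0 : 0 ≤ μ) (hμ1 : μ ≤ 1) {c : ℝ} (hc : 0 < c) :
    ∃ B ∈ optimalInvestments v c E μ, (∀ B' ∈ optimalInvestments v c E μ, B ≤ B') ∧
      utilB v μ (E μ B) / totalValue v = 1 - residual Ah Al (c / totalValue v) μ := by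
  have hφ := totalValue_pos hn hv
  have hAh0 : 0 < Ah := hAl.trans_le hAh
  simp only [mem_optimalInvestments_iff hφ]
  have hM := meanBudget_pos hAl hAh hμ0
  have hν : 0 ≤ 1 - μ := sub_nonneg.2 hμ1
  set κ := c / totalValue v with hκ
  have hκ0 : 0 < κ := by positivity
  have env := fun {B x α : ℝ} => utilB_le_envelope (v := v) (B := B) (x := x) (α := α) hn hv hAl hAh
    hE hμ0 hμ1
  have low1 := fun {B : ℝ} => le_utilB_common (v := v) (B := B) hn hv hAl hAh hE hμ0 hμ1
  have low2 := fun {B : ℝ} => le_utilB_low (v := v) (B := B) hn hv hAl hAh hE hμ0 hμ1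
  have kink1 := fun {x : ℝ} => sub_mul_le_of_mul_le (x := x) hAl hAh hμ0 hμ1
  have kink2 := fun {x : ℝ} => le_sub_mul_of_le_mul (x := x) hAl hAh hμ0 hμ1
  have h0 : 0 ≤ utilB v μ (E μ 0) / totalValue v := by
    refine div_nonneg ?_ hφ.le
    exact add_nonneg (mul_nonneg hμ0 (payoffB_nonneg hv _ _)) (mul_nonneg hν (payoffB_nonneg hv _ _))
  set f : ℝ → ℝ := fun B => utilB v μ (E μ B) / totalValue v with hf
  obtain ⟨x, hx, hx2⟩ := exists_sqrt_two_mul hκ0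
  have hlam := lam_le_iff (Al := Al) (μ := μ) hAh0 hx.le
  have hlam' := lt_lam_iff (Al := Al) (μ := μ) hAh0 hx.le
  rw [← hx2] at hlam hlam'
  have hP : 0 < √(meanBudget Ah Al μ) := Real.sqrt_pos.2 hM
  have hP2 := Real.sq_sqrt hM.le
  have hR2 := Real.sq_sqrt (mul_nonneg hν hAl.le)
  have hR : 0 ≤ √((1 - μ) * Al) := Real.sqrt_nonneg _
  have e1 : √(2 * κ * meanBudget Ah Al μ) = √(meanBudget Ah Al μ) * x := by
    rw [show 2 * κ * meanBudget Ah Al μ = meanBudget Ah Al μ * x ^ 2 by rw [hx2]; ring,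
      Real.sqrt_mul hM.le, Real.sqrt_sq hx.le]
  have e2 : √(2 * κ * ((1 - μ) * Al)) = √((1 - μ) * Al) * x := by
    rw [show 2 * κ * ((1 - μ) * Al) = (1 - μ) * Al * x ^ 2 by rw [hx2]; ring,
      Real.sqrt_mul (mul_nonneg hν hAl.le), Real.sqrt_sq hx.le]
  unfold residual
  rw [e1, e2]
  set P := √(meanBudget Ah Al μ)
  set R := √((1 - μ) * Al)
  by_cases hcM : ContestsBoth Ah Al κ μ
  · rw [if_pos hcM]
    have hPx : P * x < 1 := by
      have : (P * x) ^ 2 < 1 ^ 2 := by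
        have := hcM.1
        rw [hx2] at this
        rw [mul_pow, hP2]; linarith
      exact lt_of_pow_lt_pow_left₀ 2 zero_le_one this
    obtain ⟨b1, b2, b3⟩ := least_investment_of_envelope (f := f) (C := 1) (K := P) (x₀ := x)
      (x₁ := min (1 / P) ((R + P) / Ah)) hx
      (lt_min ((lt_div_iff₀ hP).2 (by linarith)) ((lt_div_iff₀ hAh0).2 (hlam'.1 hcM.2))) hP
      (by
        intro y hy hy1 B hB
        have hy0 : 0 < y := hx.trans_le hy
        have h1 := (lt_div_iff₀ hP).1 (hy1.trans_le (min_le_left _ _))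
        have h2 := kink1 ((lt_div_iff₀ hAh0).1 (hy1.trans_le (min_le_right _ _))).le
        exact env hB hy0 (by linarith) (by linarith [mul_pos hP hy0]) (by linarith) (by linarith))
      (by
        refine le_trans (le_of_eq ?_) (low1 (by positivity))
        rw [← hP2]; field_simp)
    rw [hx2]
    exact ⟨P / x, ⟨by positivity, b1⟩, fun B hB => b3 B hB.1 hB.2, b2⟩
  rw [if_neg hcM]
  by_cases hcL : ContestsLow Ah Al κ μ
  · rw [if_pos hcL]
    have hν0 : 0 < 1 - μ := lt_trans (by positivity) hcL.2
    have hRpos : 0 < R := Real.sqrt_pos.2 (by positivity)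
    have hRx : R * x < 1 - μ := by
      have : (R * x) ^ 2 < (1 - μ) ^ 2 := by
        have := hcL.2
        rw [hx2] at this
        rw [mul_pow, hR2]; nlinarith
      exact lt_of_pow_lt_pow_left₀ 2 hν this
    -- Beyond the crossing 1 - μ - Ry remains the higher line, so only its positivity limits x₁.
    obtain ⟨b1, b2, b3⟩ := least_investment_of_envelope (f := f) (C := 1 - μ) (K := R) (x₀ := x)
      (x₁ := (1 - μ) / R) hx
      ((lt_div_iff₀ hRpos).2 (by linarith)) hRpos
      (by
        intro y hy hy1 B hB
        have hy0 : 0 < y := hx.trans_le hy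
        have h1 := (lt_div_iff₀ hRpos).1 hy1
        have h2 := kink2 ((hlam.1 hcL.1).trans (mul_le_mul_of_nonneg_right hy hAh0.le))
        exact env hB hy0 (by linarith) (by linarith [mul_pos hRpos hy0]) (by linarith)
          (by linarith))
      (by
        refine le_trans (le_of_eq ?_) (low2 (by positivity))
        rw [← hR2]; field_simp)
    rw [hx2]
    refine ⟨R / x, ⟨by positivity, b1⟩, fun B hB => b3 B hB.1 hB.2, b2.trans ?_⟩
    ring
  · rw [if_neg hcL, sub_self]
    have hz : 1 ≤ P * x ∧ 1 - μ ≤ R * x := by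
      obtain ⟨h1, h2⟩ := (not_contests_iff hAl hAh hκ0 hμ0 hμ1).1 ⟨hcM, hcL⟩
      have hx2' : x ^ 2 = 2 * κ := by rw [hx2]; ring
      refine ⟨(sq_le_sq₀ zero_le_one (by positivity)).1 ?_, (sq_le_sq₀ hν (by positivity)).1 ?_⟩
      · rw [mul_pow, hP2, hx2']; linarith
      · rw [mul_pow, hR2, hx2']; nlinarith
    have hall : ∀ B, 0 ≤ B → f B ≤ 0 + κ * B := fun B hB => by
      rw [hx2]
      exact env hB hx le_rfl zero_le_one (by linarith) (by linarith)
    refine ⟨0, ⟨le_rfl, fun B hB => ?_⟩, fun B hB => hB.1, ?_⟩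
    · have := hall B hB
      show f B - κ * B ≤ f 0 - κ * 0
      have : 0 ≤ f 0 := h0
      linarith
    · refine le_antisymm ?_ h0
      have := hall 0 le_rfl
      linarith

end Bounds

end Investment

/-! ### The value of a signal; disclosure does not help while B contests -/

section Signaling

/-- Player A's payoff, in units of the total value, as a function of the probability `w` of the
high signal. -/
noncomputable def signalValue (Ah Al κ p w : ℝ) : ℝ :=
  w * residual Ah Al κ (p / w) + (1 - w) * residual Ah Al κ 0

variable {Ah Al κ p μ w : ℝ}

theorem residual_of_contestsBoth (h : ContestsBoth Ah Al κ μ) :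
    residual Ah Al κ μ = √(2 * κ * meanBudget Ah Al μ) / 2 := if_pos h

theorem not_contestsBoth_of_contestsLow (h : ContestsLow Ah Al κ μ) : ¬ ContestsBoth Ah Al κ μ :=
  fun h' => absurd h'.2 (not_lt.2 h.1)

theorem residual_of_contestsLow (h : ContestsLow Ah Al κ μ) :
    residual Ah Al κ μ = μ + √(2 * κ * ((1 - μ) * Al)) / 2 := by
  unfold residual
  rw [if_neg (not_contestsBoth_of_contestsLow h)]
  exact if_pos h

theorem residual_of_not (h : ¬ ContestsBoth Ah Al κ μ) (h' : ¬ ContestsLow Ah Al κ μ) :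
    residual Ah Al κ μ = 1 := by
  unfold residual
  rw [if_neg h]
  exact if_neg h'

theorem residual_le_one (hμ1 : μ ≤ 1) :
    residual Ah Al κ μ ≤ 1 := by
  by_cases h : ContestsBoth Ah Al κ μ
  · rw [residual_of_contestsBoth h]
    have := Real.sqrt_le_one.2 h.1.le
    linarith
  by_cases h' : ContestsLow Ah Al κ μ
  · rw [residual_of_contestsLow h']
    have : √(2 * κ * ((1 - μ) * Al)) ≤ 1 - μ := by
      refine Real.sqrt_le_iff.2 ⟨by linarith, ?_⟩
      nlinarith [h'.2]
    linarith
  · exact (residual_of_not h h').le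

/-- At belief 0 the mean budget is the low one, so both contested branches give the same value and
the threshold is immaterial. -/
theorem residual_zero (hκ : 2 * κ * Al < 1) : residual Ah Al κ 0 = √(2 * κ * Al) / 2 := by
  have hm : meanBudget Ah Al 0 = Al := by unfold meanBudget; ring
  rcases lt_or_ge κ (lam 1 Ah Al 0) with h | h
  · rw [residual_of_contestsBoth ⟨by rwa [hm], h⟩, hm]
  · rw [residual_of_contestsLow ⟨h, by simpa using hκ⟩]
    simp

theorem residual_eq_one_of_one_le (hAl : 0 < Al) (hAh : Al ≤ Ah) (hκ0 : 0 < κ)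
    (hκ : 1 ≤ 2 * κ * Al) (hμ0 : 0 ≤ μ) (hμ1 : μ ≤ 1) : residual Ah Al κ μ = 1 := by
  have h := (not_contests_iff hAl hAh hκ0 hμ0 hμ1).2 ⟨hκ.trans ?_, by linarith⟩
  · exact residual_of_not h.1 h.2
  · unfold meanBudget
    nlinarith [mul_le_mul_of_nonneg_left (mul_nonneg hμ0 (sub_nonneg.2 hAh)) hκ0.le]

/-- Player B contests the low type only for beliefs below a threshold. -/
theorem ContestsLow.lt_mul_sub (hAl : 0 < Al) (hAh : Al ≤ Ah) (hκ : 0 < κ) (hμ0 : 0 < μ)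
    (hμ1 : μ ≤ 1) (h : ContestsLow Ah Al κ μ) : Al < (1 - μ) * (Ah - Al) := by
  have hAh0 : 0 < Ah := hAl.trans_le hAh
  have hν : 0 < 1 - μ := lt_trans (by positivity) h.2
  have hM := meanBudget_pos hAl hAh hμ0.le
  obtain ⟨x, hx, hx2⟩ := exists_sqrt_two_mul hκ
  have hx2' : x ^ 2 = 2 * κ := by rw [hx2]; ring
  have hlam := h.1
  rw [hx2, lam_le_iff hAh0 hx.le] at hlam
  have h1 := le_sub_mul_of_le_mul hAl hAh hμ0.le hμ1 hlam
  have hP2 := Real.sq_sqrt hM.le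
  have hR2 := Real.sq_sqrt (mul_nonneg hν.le hAl.le)
  have hP : 0 < √(meanBudget Ah Al μ) := Real.sqrt_pos.2 hM
  have hR : 0 < √((1 - μ) * Al) := Real.sqrt_pos.2 (by positivity)
  set P := √(meanBudget Ah Al μ)
  set R := √((1 - μ) * Al)
  have h2 : R * x < 1 - μ := by
    refine lt_of_pow_lt_pow_left₀ 2 hν.le ?_
    rw [mul_pow, hR2, hx2']; nlinarith [h.2]
  have hPR : 0 < P - R := by
    by_contra! h'
    nlinarith
  -- Eliminating x between μ ≤ (P - R)x and Rx < 1 - μ; squaring this gives the claim after division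
  -- by `μ`.
  have h3 : R < (1 - μ) * P := by
    have := mul_le_mul_of_nonneg_left h1 hR.le
    have := mul_lt_mul_of_pos_left h2 hPR
    nlinarith
  have h4 := pow_lt_pow_left₀ h3 hR.le two_ne_zero
  rw [mul_pow, hP2, hR2] at h4
  have h5 : Al < (1 - μ) * meanBudget Ah Al μ := by
    refine lt_of_mul_lt_mul_left ?_ hν.le
    linarith
  refine lt_of_mul_lt_mul_left ?_ hμ0.le
  unfold meanBudget at h5
  linarith

/-- The sum of roots is concave in the belief, and `h` makes its derivative at `μ` nonnegative
(`key`). The chord from `p` to `μ` is compared with the slopes at `μ`. -/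
theorem sqrt_add_sqrt_le (hAl : 0 < Al) (hAh : Al ≤ Ah) (hp0 : 0 ≤ p) (hpμ : p ≤ μ) (hμ1 : μ ≤ 1)
    (h : Al < (1 - μ) * (Ah - Al)) :
    √((1 - p) * Al) + √(meanBudget Ah Al p) ≤ √((1 - μ) * Al) + √(meanBudget Ah Al μ) := by
  have hμ0 := hp0.trans hpμ
  have hΔ : 0 ≤ Ah - Al := by linarith
  have hν : 0 < 1 - μ := by
    rcases hμ1.eq_or_lt with rfl | h'
    · simp at h; linarith
    · linarith
  have mμ := meanBudget_pos hAl hAh hμ0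
  have mp := meanBudget_pos hAl hAh hp0
  have hP : 0 < √(meanBudget Ah Al μ) := Real.sqrt_pos.2 mμ
  have hp : 0 < √(meanBudget Ah Al p) := Real.sqrt_pos.2 mp
  have hR : 0 < √((1 - μ) * Al) := Real.sqrt_pos.2 (by positivity)
  have hr : √((1 - μ) * Al) ≤ √((1 - p) * Al) := Real.sqrt_le_sqrt (by nlinarith)
  have hpP : √(meanBudget Ah Al p) ≤ √(meanBudget Ah Al μ) := by
    refine Real.sqrt_le_sqrt ?_
    unfold meanBudget; nlinarith
  have hP2 := Real.sq_sqrt mμ.le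
  have hp2 := Real.sq_sqrt mp.le
  have hR2 := Real.sq_sqrt (mul_nonneg hν.le hAl.le)
  have hr2 := Real.sq_sqrt (mul_nonneg (by linarith : 0 ≤ 1 - p) hAl.le)
  have key : Al * √(meanBudget Ah Al μ) ≤ (Ah - Al) * √((1 - μ) * Al) := by
    refine le_of_sq_le_sq ?_ (by positivity)
    rw [mul_pow, mul_pow, hP2, hR2]
    unfold meanBudget
    have : Al * (Ah - Al + Al) ≤ (1 - μ) * (Ah - Al) * (Ah - Al + Al) :=
      mul_le_mul_of_nonneg_right h.le (by linarith)
    nlinarith [mul_le_mul_of_nonneg_left this hAl.le]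
  have dP : (√(meanBudget Ah Al μ) - √(meanBudget Ah Al p)) *
      (√(meanBudget Ah Al μ) + √(meanBudget Ah Al p)) = (μ - p) * (Ah - Al) := by
    have : meanBudget Ah Al μ - meanBudget Ah Al p = (μ - p) * (Ah - Al) := by
      unfold meanBudget; ring
    linear_combination hP2 - hp2 + this
  have dR : (√((1 - p) * Al) - √((1 - μ) * Al)) * (√((1 - p) * Al) + √((1 - μ) * Al)) =
      (μ - p) * Al := by linear_combination hr2 - hR2
  set P := √(meanBudget Ah Al μ)
  set P' := √(meanBudget Ah Al p)
  set R := √((1 - μ) * Al)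
  set R' := √((1 - p) * Al)
  have h1 : (μ - p) * (Ah - Al) ≤ (P - P') * (2 * P) := by
    rw [← dP]; exact mul_le_mul_of_nonneg_left (by linarith) (by linarith)
  have h2 : (R' - R) * (2 * R) ≤ (μ - p) * Al := by
    rw [← dR]; exact mul_le_mul_of_nonneg_left (by linarith) (by linarith)
  have h3 : (R' - R) * (2 * R * P) ≤ (P - P') * (2 * R * P) := by
    calc (R' - R) * (2 * R * P) = (R' - R) * (2 * R) * P := by ring
      _ ≤ (μ - p) * Al * P := mul_le_mul_of_nonneg_right h2 hP.le
      _ = (μ - p) * (Al * P) := by ring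
      _ ≤ (μ - p) * ((Ah - Al) * R) := mul_le_mul_of_nonneg_left key (by linarith)
      _ = (μ - p) * (Ah - Al) * R := by ring
      _ ≤ (P - P') * (2 * P) * R := mul_le_mul_of_nonneg_right h1 hR.le
      _ = _ := by ring
  have h4 := le_of_mul_le_mul_right h3 (by positivity)
  linarith

theorem lam_mono (hAl : 0 < Al) (hAh : Al ≤ Ah) (hp0 : 0 ≤ p) (hpμ : p ≤ μ) (hμ1 : μ ≤ 1)
    (h : Al < (1 - μ) * (Ah - Al)) : lam 1 Ah Al p ≤ lam 1 Ah Al μ := by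
  have := sqrt_add_sqrt_le hAl hAh hp0 hpμ hμ1 h
  unfold lam
  unfold meanBudget at this
  gcongr

/-- Multiply both roots by √(A_h - A_ℓ) and apply AM-GM to each; the two bounds add up to A_h. Hence
B never contests both types once 2κ(A_h - A_ℓ) ≥ 1. -/
theorem two_mul_lam_mul_sub_le (hAl : 0 < Al) (hAh : Al ≤ Ah) (hμ0 : 0 ≤ μ) (hμ1 : μ ≤ 1) :
    2 * lam 1 Ah Al μ * (Ah - Al) ≤ 1 := by
  have hΔ : 0 ≤ Ah - Al := by linarith
  have hAh0 : 0 < Ah := hAl.trans_le hAh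
  have hν : 0 ≤ 1 - μ := by linarith
  have mμ := meanBudget_pos hAl hAh hμ0
  have hP2 := Real.sq_sqrt mμ.le
  have hR2 := Real.sq_sqrt (mul_nonneg hν hAl.le)
  have hd2 := Real.sq_sqrt hΔ
  have h1 : √((1 - μ) * Al) * √(Ah - Al) ≤ ((1 - μ) * (Ah - Al) + Al) / 2 := by
    refine le_of_sq_le_sq ?_ (by positivity)
    rw [mul_pow, hR2, hd2]
    nlinarith [sq_nonneg ((1 - μ) * (Ah - Al) - Al)]
  have h2 : √(meanBudget Ah Al μ) * √(Ah - Al) ≤ (meanBudget Ah Al μ + (Ah - Al)) / 2 := by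
    refine le_of_sq_le_sq ?_ (by positivity)
    rw [mul_pow, hP2, hd2]
    nlinarith [sq_nonneg (meanBudget Ah Al μ - (Ah - Al))]
  have h3 : (√((1 - μ) * Al) + √(meanBudget Ah Al μ)) * √(Ah - Al) ≤ Ah := by
    have : meanBudget Ah Al μ = Al + μ * (Ah - Al) := by unfold meanBudget; ring
    linarith
  have h4 := pow_le_pow_left₀ (by positivity) h3 2
  rw [mul_pow, hd2] at h4
  have e : 2 * lam 1 Ah Al μ * (Ah - Al) =
      (√((1 - μ) * Al) + √(meanBudget Ah Al μ)) ^ 2 * (Ah - Al) / Ah ^ 2 := by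
    unfold lam meanBudget
    field_simp
  rw [e, div_le_one (by positivity)]
  exact h4

theorem mul_sqrt_div (hw : 0 < w) (y : ℝ) : w * √(y / w) = √(w * y) := by
  rw [show w * y = w ^ 2 * (y / w) by field_simp, Real.sqrt_mul (sq_nonneg w), Real.sqrt_sq hw.le]

theorem signalValue_of_contestsBoth (hκ : 2 * κ * Al < 1) (hw : 0 < w)
    (h : ContestsBoth Ah Al κ (p / w)) : signalValue Ah Al κ p w =
      √(w * (2 * κ * (p * (Ah - Al)) + w * (2 * κ * Al))) / 2 + (1 - w) * (√(2 * κ * Al) / 2) := by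
  unfold signalValue
  rw [residual_zero hκ, residual_of_contestsBoth h, mul_div_assoc', ← mul_sqrt_div hw]
  have : 2 * κ * meanBudget Ah Al (p / w) =
      (2 * κ * (p * (Ah - Al)) + w * (2 * κ * Al)) / w := by
    unfold meanBudget
    field_simp
    ring
  rw [this]

theorem signalValue_of_contestsLow (hAl : 0 < Al) (hκ0 : 0 < κ) (hκ : 2 * κ * Al < 1) (hw : 0 < w)
    (h : ContestsLow Ah Al κ (p / w)) : signalValue Ah Al κ p w =
      p + √(w * (w - p)) * √(2 * κ * Al) / 2 + (1 - w) * (√(2 * κ * Al) / 2) := by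
  unfold signalValue
  rw [residual_zero hκ, residual_of_contestsLow h, ← mul_sqrt_div hw,
    show 2 * κ * ((1 - p / w) * Al) = (w - p) / w * (2 * κ * Al) by field_simp,
    Real.sqrt_mul' _ (by positivity)]
  field_simp

theorem signalValue_of_not (hκ : 2 * κ * Al < 1)
    (h : ¬ ContestsBoth Ah Al κ (p / w)) (h' : ¬ ContestsLow Ah Al κ (p / w)) :
    signalValue Ah Al κ p w = w + (1 - w) * (√(2 * κ * Al) / 2) := by
  unfold signalValue
  rw [residual_zero hκ, residual_of_not h h', mul_one]

/-- Cauchy-Schwarz for the weights w, 1 - w and the summands d + wa², (1 - w)a²; the defect of the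
squared inequality is (1 - w)(√(d + a²) - a)². -/
theorem sqrt_mul_add_le {d a : ℝ} (hd : 0 ≤ d) (ha : 0 ≤ a) (hw0 : 0 ≤ w) (hw1 : w ≤ 1) :
    √(w * (d + w * a ^ 2)) + (1 - w) * a ≤ √(d + a ^ 2) := by
  have hs : √(d + a ^ 2) ^ 2 = d + a ^ 2 := Real.sq_sqrt (by positivity)
  have hs0 : 0 ≤ √(d + a ^ 2) := Real.sqrt_nonneg _
  have hsa : a ≤ √(d + a ^ 2) := Real.le_sqrt_of_sq_le (by linarith)
  have : √(w * (d + w * a ^ 2)) ≤ √(d + a ^ 2) - (1 - w) * a := by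
    refine Real.sqrt_le_iff.2 ⟨by nlinarith, ?_⟩
    have h1 := mul_nonneg (sub_nonneg.2 hw1) (sq_nonneg (√(d + a ^ 2) - a))
    nlinarith
  linarith

theorem sqrt_mul_sub_le (hpw : p ≤ w) (hw1 : w ≤ 1) (hp0 : 0 ≤ p) :
    √(w * (w - p)) + (1 - w) ≤ √(1 - p) := by
  have hs : √(1 - p) ^ 2 = 1 - p := Real.sq_sqrt (by linarith)
  have hs0 : 0 ≤ √(1 - p) := Real.sqrt_nonneg _
  have hs1 : √(1 - p) ≤ 1 := Real.sqrt_le_one.2 (by linarith)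
  have : √(w * (w - p)) ≤ √(1 - p) - (1 - w) := by
    refine Real.sqrt_le_iff.2 ⟨by nlinarith, ?_⟩
    have h1 := mul_nonneg (sub_nonneg.2 hw1) (sq_nonneg (√(1 - p) - 1))
    nlinarith
  linarith

/-- If the branches at p and p/w agree, concavity of the residual suffices. If both types are
contested at p/w but only the low one at p, the residual at p/w lies below the low-branch formula,
to which concavity applies. The reverse combination cannot occur, because the threshold increases up
to p/w (`lam_mono`). -/
theorem signalValue_le_of_contests (hAl : 0 < Al) (hAh : Al ≤ Ah) (hκ0 : 0 < κ)
    (hκ : 2 * κ * Al < 1) (hp0 : 0 < p) (hpw : p ≤ w) (hw1 : w ≤ 1)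
    (h1 : ContestsBoth Ah Al κ p ∨ ContestsLow Ah Al κ p)
    (hw : ContestsBoth Ah Al κ (p / w) ∨ ContestsLow Ah Al κ (p / w)) :
    signalValue Ah Al κ p w ≤ signalValue Ah Al κ p 1 := by
  have hw0 : 0 < w := hp0.trans_le hpw
  have hpμ : p ≤ p / w := by rw [le_div_iff₀ hw0]; nlinarith
  have hμ0 : 0 < p / w := by positivity
  have hμ1 : p / w ≤ 1 := (div_le_one hw0).2 hpw
  have ha : 0 ≤ √(2 * κ * Al) := Real.sqrt_nonneg _
  have ha2 : √(2 * κ * Al) ^ 2 = 2 * κ * Al := Real.sq_sqrt (by positivity)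
  have hd : 0 ≤ 2 * κ * (p * (Ah - Al)) :=
    mul_nonneg (by positivity) (mul_nonneg hp0.le (by linarith))
  have one_low : ContestsLow Ah Al κ p → signalValue Ah Al κ p 1 =
      p + √(1 - p) * √(2 * κ * Al) / 2 := fun h => by
    rw [signalValue_of_contestsLow hAl hκ0 hκ one_pos (by simpa using h)]
    simp
  have low_le : p + √(w * (w - p)) * √(2 * κ * Al) / 2 + (1 - w) * (√(2 * κ * Al) / 2) ≤
      p + √(1 - p) * √(2 * κ * Al) / 2 := by
    have := mul_le_mul_of_nonneg_right (sqrt_mul_sub_le hpw hw1 hp0.le) ha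
    linarith
  rcases hw with hw | hw
  · rcases h1 with h1 | h1
    · rw [signalValue_of_contestsBoth hκ hw0 hw,
        signalValue_of_contestsBoth hκ one_pos (by simpa using h1)]
      have := sqrt_mul_add_le hd ha hw0.le hw1
      rw [ha2] at this
      simp only [one_mul, sub_self, zero_mul, add_zero]
      linarith
    · rw [one_low h1]
      refine le_trans ?_ low_le
      have e := signalValue_of_contestsBoth hκ hw0 hw
      unfold signalValue at e ⊢
      rw [residual_zero hκ] at e ⊢
      rw [residual_of_contestsBoth hw]
      have hk : √(2 * κ * meanBudget Ah Al (p / w)) / 2 ≤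
          p / w + √(2 * κ * ((1 - p / w) * Al)) / 2 := by
        obtain ⟨x, hx, hx2⟩ := exists_sqrt_two_mul hκ0
        have hlt := hw.2
        rw [hx2, lt_lam_iff (hAl.trans_le hAh) hx.le] at hlt
        have h2 := sub_mul_le_of_mul_le hAl hAh hμ0.le hμ1 hlt.le
        have hx3 : √(2 * κ) = x := by
          rw [show 2 * κ = x ^ 2 by rw [hx2]; ring, Real.sqrt_sq hx.le]
        rw [Real.sqrt_mul (by positivity), Real.sqrt_mul (by positivity : (0 : ℝ) ≤ 2 * κ), hx3]
        linarith
      have h3 := mul_le_mul_of_nonneg_left hk hw0.le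
      have h4 : w * (p / w + √(2 * κ * ((1 - p / w) * Al)) / 2) =
          p + √(w * (w - p)) * √(2 * κ * Al) / 2 := by
        rw [← mul_sqrt_div hw0, show 2 * κ * ((1 - p / w) * Al) = (w - p) / w * (2 * κ * Al) by
          field_simp, Real.sqrt_mul' _ (by positivity)]
        field_simp
      linarith
  · have hlam := (lam_mono hAl hAh hp0.le hpμ hμ1
      (hw.lt_mul_sub hAl hAh hκ0 hμ0 hμ1)).trans hw.1
    have h1 : ContestsLow Ah Al κ p := ⟨hlam, by linarith [hw.2]⟩
    rw [one_low h1, signalValue_of_contestsLow hAl hκ0 hκ hw0 hw]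
    exact low_le

end Signaling

/-! ### Comparing the abstention threshold with the trivial policy -/

section Comparison

variable {Ah Al κ p w : ℝ}

/-- `w₀` is the only maximizer of `W` on `[p, 1]`, and it is not `1`. -/
def IsStrictMaximizer (W : ℝ → ℝ) (p w₀ : ℝ) : Prop :=
  p ≤ w₀ ∧ w₀ ≤ 1 ∧ W 1 < W w₀ ∧ ∀ w, p ≤ w → w ≤ 1 → w ≠ w₀ → W w < W w₀

theorem isStrictMaximizer_of_threshold {W : ℝ → ℝ} {a w₀ : ℝ} (ha : a < 1) (hp : p ≤ w₀)
    (hw₀ : w₀ < 1) (hlow : ∀ w, p ≤ w → w ≤ w₀ → W w = w + (1 - w) * (a / 2))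
    (hhigh : ∀ w, w₀ < w → w ≤ 1 → W w ≤ W 1) (h : W 1 < W w₀) : IsStrictMaximizer W p w₀ := by
  refine ⟨hp, hw₀.le, h, fun w hpw hw1 hne => ?_⟩
  rcases lt_or_gt_of_ne hne with h' | h'
  · rw [hlow w hpw h'.le, hlow w₀ hp le_rfl]
    nlinarith
  · exact (hhigh w h' hw1).trans_lt h

theorem le_of_threshold {W : ℝ → ℝ} {a w₀ : ℝ} (ha : a < 1) (hp : p ≤ w₀)
    (hlow : ∀ w, p ≤ w → w ≤ w₀ → W w = w + (1 - w) * (a / 2))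
    (hhigh : ∀ w, w₀ < w → w ≤ 1 → W w ≤ W 1) (h : W w₀ ≤ W 1) :
    ∀ w, p ≤ w → w ≤ 1 → W w ≤ W 1 := by
  intro w hpw hw1
  rcases le_or_gt w w₀ with h' | h'
  · refine le_trans ?_ h
    rw [hlow w hpw h', hlow w₀ hp le_rfl]
    nlinarith
  · exact hhigh w h' hw1

/-- For equal budgets the quotient is 0 by convention, so both sides fail; this is how conditions 2
and 3 become violated then. -/
theorem lt_threshold_iff (hAl : 0 < Al) (hAh : Al ≤ Ah) (hp0 : 0 < p) :
    p < (Ah - 2 * Al) / (Ah - Al) ↔ Al < (1 - p) * (Ah - Al) := by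
  rcases hAh.eq_or_lt with rfl | h
  · simp only [sub_self, div_zero, mul_zero]
    constructor <;> intro h <;> linarith
  · rw [lt_div_iff₀ (sub_pos.2 h)]
    constructor <;> intro h <;> linarith

theorem region1_one_iff (hAl : 0 < Al) (hAh : Al ≤ Ah) :
    Region1 1 Ah Al κ p ↔ 0 < p ∧ 1 ≤ 2 * κ * Ah ∧ ContestsBoth Ah Al κ p := by
  have hAh0 : 0 < Ah := hAl.trans_le hAh
  unfold Region1 ContestsBoth
  refine and_congr_right fun hp => ?_
  rw [lt_min_iff, div_le_iff₀ (by positivity),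
    lt_div_iff₀ (mul_pos two_pos (meanBudget_pos hAl hAh hp.le)),
    show κ * (2 * Ah) = 2 * κ * Ah by ring,
    show κ * (2 * meanBudget Ah Al p) = 2 * κ * meanBudget Ah Al p by ring]

theorem sqrt_div_four :
    √(κ * 1 * Al / 2) = √(2 * κ * Al) / 2 := by
  rw [show κ * 1 * Al / 2 = 2 * κ * Al / 2 ^ 2 by ring, Real.sqrt_div' _ (by positivity),
    Real.sqrt_sq two_pos.le]

theorem region2_one_iff (hAl : 0 < Al) (hAh : Al ≤ Ah) :
    Region2 1 Ah Al κ p ↔ 0 < p ∧ lam 1 Ah Al p ≤ κ ∧ 1 < 2 * κ * Ah ∧ 2 * κ * (Ah - Al) < 1 ∧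
      Al < (1 - p) * (Ah - Al) ∧ (1 - 2 * κ * Al) / (2 * κ * Ah - 1) *
        (√(2 * κ * Al) / 2 / (1 - √(2 * κ * Al) / 2)) < fp p := by
  have hAh0 : 0 < Ah := hAl.trans_le hAh
  unfold Region2
  rw [sqrt_div_four]
  refine and_congr_right fun hp => and_congr_right fun _ => ?_
  rw [lt_threshold_iff hAl hAh hp, div_lt_iff₀ (by positivity),
    show κ * (2 * Ah) = 2 * κ * Ah by ring]
  refine and_congr_right fun _ => ?_
  constructor
  · rintro ⟨h1, h2, h3⟩
    refine ⟨?_, h2, h3⟩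
    have hΔ : 0 < Ah - Al := by
      rcases hAh.eq_or_lt with rfl | h
      · simp at h2; linarith
      · linarith
    rw [lt_div_iff₀ (by positivity)] at h1
    linarith
  · rintro ⟨h1, h2, h3⟩
    refine ⟨?_, h2, h3⟩
    have hΔ : 0 < Ah - Al := by
      rcases hAh.eq_or_lt with rfl | h
      · simp at h2; linarith
      · linarith
    rw [lt_div_iff₀ (by positivity)]
    linarith

theorem region3_one_iff (hAl : 0 < Al) (hAh : Al ≤ Ah) :
    Region3 1 Ah Al κ p ↔ 0 < p ∧ 1 ≤ 2 * κ * (Ah - Al) ∧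
      ((fp p - √(fp p ^ 2 - fp p + 1)) / (fp p - 1)) ^ 2 < 2 * κ * Al ∧
      2 * κ * Al < 1 - p ∧ Al < (1 - p) * (Ah - Al) := by
  unfold Region3
  refine and_congr_right fun hp => ?_
  rw [lt_threshold_iff hAl hAh hp, lt_div_iff₀ (by positivity : 0 < 2 * Al), mul_one,
    show κ * (2 * Al) = 2 * κ * Al by ring, one_div_mul_eq_div, div_lt_iff₀ (by positivity),
    show κ * (2 * Al) = 2 * κ * Al by ring]
  constructor
  · rintro ⟨h1, h2, h3, h4⟩
    refine ⟨?_, h2, h3, h4⟩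
    have hΔ : 0 < Ah - Al := by
      rcases hAh.eq_or_lt with rfl | h
      · simp at h4; linarith
      · linarith
    rw [div_le_iff₀ (by positivity)] at h1
    linarith
  · rintro ⟨h1, h2, h3, h4⟩
    refine ⟨?_, h2, h3, h4⟩
    have hΔ : 0 < Ah - Al := by
      rcases hAh.eq_or_lt with rfl | h
      · simp at h4; linarith
      · linarith
    rw [div_le_iff₀ (by positivity)]
    linarith

theorem fp_eq (hp0 : 0 < p) (hp1 : p < 1) : fp p = (1 + √(1 - p)) / √(1 - p) := by
  have hr2 : √(1 - p) ^ 2 = 1 - p := Real.sq_sqrt (by linarith)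
  have hr0 : 0 < √(1 - p) := Real.sqrt_pos.2 (by linarith)
  have hr1 : √(1 - p) < 1 := (Real.sqrt_lt' one_pos).2 (by linarith)
  unfold fp
  set r := √(1 - p)
  have h : 0 < r - (1 - p) := by rw [← hr2]; nlinarith
  rw [div_eq_div_iff h.ne' hr0.ne']
  have : p = 1 - r ^ 2 := by linarith
  rw [this]
  ring

/-- With r = √(1-p) we have p = (1 - r)(1 + r), a factor 1 - r cancels, and f_p = (1 + r)/r remains.
-/
theorem low_lt_iff (hp0 : 0 < p) (hp1 : p < 1) {a Q : ℝ} (ha1 : a < 1) (hQ : 0 < Q) :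
    p + √(1 - p) * a / 2 < (p + p * Q) + (1 - (p + p * Q)) * (a / 2) ↔
      1 / Q * (a / 2 / (1 - a / 2)) < fp p := by
  rw [fp_eq hp0 hp1]
  have hr2 : √(1 - p) ^ 2 = 1 - p := Real.sq_sqrt (by linarith)
  have hr0 : 0 < √(1 - p) := Real.sqrt_pos.2 (by linarith)
  have hr1 : √(1 - p) < 1 := (Real.sqrt_lt' one_pos).2 (by linarith)
  set r := √(1 - p)
  clear_value r
  obtain rfl : p = 1 - r ^ 2 := by linarith
  have hD : 0 < Q * (1 - a / 2) := mul_pos hQ (by linarith)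
  have e : 1 / Q * (a / 2 / (1 - a / 2)) = a / 2 / (Q * (1 - a / 2)) := by
    rw [div_mul_div_comm, one_mul]
  rw [e, div_lt_div_iff₀ hD hr0]
  have h1r : 0 < 1 - r := by linarith
  constructor
  · intro h
    refine lt_of_mul_lt_mul_right ?_ h1r.le
    nlinarith
  · intro h
    have := mul_lt_mul_of_pos_right h h1r
    nlinarith

/-- The left side isolates a root of a quadratic in `a`. Squaring and cancelling f - 1 turns it into
1 - a² < f a(2 - a), which is `low_lt_iff` for Q = a²/(1 - a²). -/
theorem root_sq_lt_iff {f a : ℝ} (hf : 1 < f) (ha0 : 0 < a) (ha1 : a < 1) :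
    ((f - √(f ^ 2 - f + 1)) / (f - 1)) ^ 2 < a ^ 2 ↔
      1 / (a ^ 2 / (1 - a ^ 2)) * (a / 2 / (1 - a / 2)) < f := by
  have hf1 : 0 < f - 1 := by linarith
  have hs0 : 0 ≤ √(f ^ 2 - f + 1) := Real.sqrt_nonneg _
  have hle : √(f ^ 2 - f + 1) ≤ f := Real.sqrt_le_iff.2 ⟨by linarith, by linarith⟩
  rw [sq_lt_sq₀ (div_nonneg (by linarith) hf1.le) ha0.le, div_lt_iff₀ hf1]
  have e : 1 / (a ^ 2 / (1 - a ^ 2)) * (a / 2 / (1 - a / 2)) = (1 - a ^ 2) / (a * (2 - a)) := by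
    have : 2 - a ≠ 0 := by linarith
    field_simp
  rw [e, div_lt_iff₀ (mul_pos ha0 (by linarith)), sub_lt_comm,
    Real.lt_sqrt (by nlinarith)]
  constructor
  · intro h
    refine lt_of_mul_lt_mul_left ?_ hf1.le
    nlinarith
  · intro h
    have := mul_lt_mul_of_pos_left h hf1
    nlinarith

/-- After multiplication by 1 - a² and division by b - a the claim is 1 - a² < (a + b)(2 - a). It
follows from a + b > 1 and 2 - a > 1. -/
theorem both_lt {a b x w₀ : ℝ} (ha0 : 0 < a) (hab : a < b) (hb : b < 1)
    (h : 1 < b + x * a) (hx : x ≤ 1) (hw₀ : w₀ * (1 - a ^ 2) = b ^ 2 - a ^ 2) :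
    b / 2 < w₀ + (1 - w₀) * (a / 2) := by
  have hD : 0 < 1 - a ^ 2 := by nlinarith
  have h1 : 1 < b + a := by nlinarith
  have h2 : (1 - a ^ 2) < (b + a) * (2 - a) := by nlinarith
  have h3 := mul_lt_mul_of_pos_left h2 (sub_pos.2 hab)
  refine lt_of_mul_lt_mul_right ?_ hD.le
  have e : (w₀ + (1 - w₀) * (a / 2)) * (1 - a ^ 2) =
      (w₀ * (1 - a ^ 2)) * (1 - a / 2) + (1 - a ^ 2) * (a / 2) := by ring
  rw [e, hw₀]
  nlinarith

theorem signalValue_trichotomy (hAl : 0 < Al) (hAh : Al ≤ Ah) (hκ : 0 < κ) (hp0 : 0 < p)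
    (hp1 : p < 1) :
    (¬ Region1 1 Ah Al κ p ∧ ¬ Region2 1 Ah Al κ p ∧ ¬ Region3 1 Ah Al κ p ∧
      ∀ w, p ≤ w → w ≤ 1 → signalValue Ah Al κ p w ≤ signalValue Ah Al κ p 1) ∨
    ((Region1 1 Ah Al κ p ∨ Region2 1 Ah Al κ p) ∧ ¬ Region3 1 Ah Al κ p ∧
      IsStrictMaximizer (signalValue Ah Al κ p) p
        (p + p * ((2 * κ * Ah - 1) / (1 - 2 * κ * Al)))) ∨
    (¬ Region1 1 Ah Al κ p ∧ ¬ Region2 1 Ah Al κ p ∧ Region3 1 Ah Al κ p ∧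
      IsStrictMaximizer (signalValue Ah Al κ p) p
        (p + p * (2 * κ * Al / (1 - 2 * κ * Al)))) := by
  rw [region1_one_iff hAl hAh, region2_one_iff hAl hAh, region3_one_iff hAl hAh]
  have hAh0 : 0 < Ah := hAl.trans_le hAh
  have hlamΔ := two_mul_lam_mul_sub_le hAl hAh hp0.le hp1.le
  have hκA : 0 < 2 * κ * Al := by positivity
  have hΔ0 : 0 ≤ 2 * κ * (Ah - Al) := mul_nonneg (by positivity) (sub_nonneg.2 hAh)
  have hmean : ∀ μ, meanBudget Ah Al μ = Al + μ * (Ah - Al) := fun μ => by unfold meanBudget; ring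
  have hμ : ∀ w, p ≤ w → 0 < w ∧ 0 < p / w ∧ p / w ≤ 1 := fun w hw =>
    have hw0 := hp0.trans_le hw
    ⟨hw0, by positivity, (div_le_one hw0).2 hw⟩
  have low_of : Al < (1 - p) * (Ah - Al) → 2 * κ * (Ah - Al) < 1 → 2 * κ * Al < 1 - p := by
    intro h1 h2
    have h3 := mul_lt_mul_of_pos_left h1 (by positivity : 0 < 2 * κ)
    nlinarith
  have lam_le_of : 1 ≤ 2 * κ * (Ah - Al) → lam 1 Ah Al p ≤ κ := by
    intro h
    have hΔ : 0 < Ah - Al := by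
      by_contra! h'
      nlinarith
    refine le_of_mul_le_mul_right ?_ hΔ
    linarith
  rcases le_or_gt 1 (2 * κ * Al) with hA | hA
  · left
    refine ⟨fun h => ?_, fun h => ?_, fun h => ?_, fun w hw hw1 => ?_⟩
    · have := h.2.2.1
      rw [hmean] at this
      nlinarith [mul_nonneg hp0.le hΔ0]
    · linarith [low_of h.2.2.2.2.1 h.2.2.2.1]
    · linarith [h.2.2.2.1]
    · obtain ⟨hw0, hμ0, hμ1⟩ := hμ w hw
      unfold signalValue
      rw [residual_eq_one_of_one_le hAl hAh hκ hA hμ0.le hμ1,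
        residual_eq_one_of_one_le hAl hAh hκ hA le_rfl zero_le_one,
        residual_eq_one_of_one_le hAl hAh hκ hA (by simpa using hp0.le) (by simpa using hp1.le)]
      linarith
  have ha0 : 0 < √(2 * κ * Al) := Real.sqrt_pos.2 hκA
  have ha1 : √(2 * κ * Al) < 1 := by
    rw [← Real.sqrt_one]; exact Real.sqrt_lt_sqrt hκA.le hA
  have ha2 : √(2 * κ * Al) ^ 2 = 2 * κ * Al := Real.sq_sqrt hκA.le
  by_cases hcp : ContestsBoth Ah Al κ p ∨ ContestsLow Ah Al κ p
  swap
  · left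
    push Not at hcp
    refine ⟨fun h => hcp.1 h.2.2, fun h => hcp.2 ⟨h.2.1, low_of h.2.2.2.2.1 h.2.2.2.1⟩,
      fun h => hcp.2 ⟨lam_le_of h.2.1, h.2.2.2.1⟩, fun w hw hw1 => ?_⟩
    obtain ⟨hw0, hμ0, hμ1⟩ := hμ w hw
    rw [signalValue_of_not (w := 1) hA (by simpa using hcp.1) (by simpa using hcp.2)]
    unfold signalValue
    rw [residual_zero hA]
    have := residual_le_one (Ah := Ah) (Al := Al) (κ := κ) hμ1
    nlinarith
  have hcont : ∀ w, p ≤ w → w ≤ 1 → ¬ (¬ ContestsBoth Ah Al κ (p / w) ∧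
      ¬ ContestsLow Ah Al κ (p / w)) → signalValue Ah Al κ p w ≤ signalValue Ah Al κ p 1 :=
    fun w hw hw1 h => signalValue_le_of_contests hAl hAh hκ hA hp0 hw hw1 hcp (by tauto)
  rcases lt_or_ge (2 * κ * Ah) 1 with hH | hH
  · left
    refine ⟨fun h => by linarith [h.2.1], fun h => by linarith [h.2.2.1],
      fun h => by linarith [h.2.1], fun w hw hw1 => hcont w hw hw1 fun h => ?_⟩
    obtain ⟨hw0, hμ0, hμ1⟩ := hμ w hw
    have := ((not_contests_iff hAl hAh hκ hμ0.le hμ1).1 h).1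
    rw [hmean] at this
    nlinarith
  have hΔ : 0 < 2 * κ * (Ah - Al) := by linarith
  -- From here on some beliefs may make B abstain, while B contests at w = 1; any abstention
  -- threshold therefore lies below 1.
  have hD : 0 < 1 - 2 * κ * Al := by linarith
  have not_p_of : ∀ w₀, (∀ w, p ≤ w → w ≤ 1 → ((¬ ContestsBoth Ah Al κ (p / w) ∧
      ¬ ContestsLow Ah Al κ (p / w)) ↔ w ≤ w₀)) → w₀ < 1 := by
    intro w₀ h
    by_contra! h'
    have := (h 1 hp1.le le_rfl).2 h'
    rw [div_one] at this
    tauto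
  have low_of_thr : ∀ w₀, (∀ w, p ≤ w → w ≤ 1 → ((¬ ContestsBoth Ah Al κ (p / w) ∧
      ¬ ContestsLow Ah Al κ (p / w)) ↔ w ≤ w₀)) → ∀ w, p ≤ w → w ≤ w₀ →
      signalValue Ah Al κ p w = w + (1 - w) * (√(2 * κ * Al) / 2) := by
    intro w₀ h w hw hw₀
    have := (h w hw (hw₀.trans (not_p_of w₀ h).le)).2 hw₀
    exact signalValue_of_not hA this.1 this.2
  have high_of_thr : ∀ w₀, p ≤ w₀ → (∀ w, p ≤ w → w ≤ 1 → ((¬ ContestsBoth Ah Al κ (p / w) ∧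
      ¬ ContestsLow Ah Al κ (p / w)) ↔ w ≤ w₀)) → ∀ w, w₀ < w → w ≤ 1 →
      signalValue Ah Al κ p w ≤ signalValue Ah Al κ p 1 := by
    intro w₀ hpw₀ h w hw hw1
    have hpw := hpw₀.trans hw.le
    exact hcont w hpw hw1 fun h' => not_lt.2 ((h w hpw hw1).1 h') hw
  have one_low : ContestsLow Ah Al κ p → signalValue Ah Al κ p 1 =
      p + √(1 - p) * √(2 * κ * Al) / 2 := fun h => by
    rw [signalValue_of_contestsLow hAl hκ hA one_pos (by simpa using h)]
    simp
  rcases lt_or_ge (2 * κ * (Ah - Al)) 1 with hΔ1 | hΔ1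
  · set w₀ := p + p * ((2 * κ * Ah - 1) / (1 - 2 * κ * Al)) with hw₀
    have hQ : 0 ≤ (2 * κ * Ah - 1) / (1 - 2 * κ * Al) := div_nonneg (by linarith) hD.le
    have hw₀' : w₀ * (1 - 2 * κ * Al) = p * (2 * κ * (Ah - Al)) := by
      rw [hw₀]; field_simp; ring
    have hpw₀ : p ≤ w₀ := by rw [hw₀]; nlinarith
    have thr : ∀ w, p ≤ w → w ≤ 1 → ((¬ ContestsBoth Ah Al κ (p / w) ∧
        ¬ ContestsLow Ah Al κ (p / w)) ↔ w ≤ w₀) := by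
      intro w hw hw1
      obtain ⟨hw0, hμ0, hμ1⟩ := hμ w hw
      have h1 : 1 ≤ 2 * κ * meanBudget Ah Al (p / w) ↔ w ≤ w₀ := by
        rw [show w ≤ w₀ ↔ w * _ ≤ w₀ * _ from (mul_le_mul_iff_left₀ hD).symm, hw₀', hmean,
          show 2 * κ * (Al + p / w * (Ah - Al)) = 2 * κ * Al + p * (2 * κ * (Ah - Al)) / w by ring,
          ← sub_le_iff_le_add', le_div_iff₀ hw0, mul_comm w]
      rw [not_contests_iff hAl hAh hκ hμ0.le hμ1, h1, and_iff_left_iff_imp, ← h1, hmean]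
      intro h
      by_contra! h2
      nlinarith [mul_pos (sub_pos.2 hΔ1) hD]
    have hw₀1 := not_p_of w₀ thr
    have hlow := low_of_thr w₀ thr
    have hhigh := high_of_thr w₀ hpw₀ thr
    have n3 : ¬ (0 < p ∧ 1 ≤ 2 * κ * (Ah - Al) ∧
      ((fp p - √(fp p ^ 2 - fp p + 1)) / (fp p - 1)) ^ 2 < 2 * κ * Al ∧
      2 * κ * Al < 1 - p ∧ Al < (1 - p) * (Ah - Al)) := fun h => by linarith [h.2.1]
    rcases hcp with hcp | hcp
    · right; left
      refine ⟨Or.inl ⟨hp0, hH, hcp⟩, n3, isStrictMaximizer_of_threshold ha1 hpw₀ hw₀1 hlow hhigh ?_⟩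
      have hM := meanBudget_pos hAl hAh hp0.le
      have hb2 : √(2 * κ * meanBudget Ah Al p) ^ 2 = 2 * κ * meanBudget Ah Al p :=
        Real.sq_sqrt (by positivity)
      have hW1 : signalValue Ah Al κ p 1 = √(2 * κ * meanBudget Ah Al p) / 2 := by
        unfold signalValue
        rw [div_one, residual_of_contestsBoth hcp]
        ring
      rw [hlow w₀ hpw₀ le_rfl, hW1]
      have hab : √(2 * κ * Al) < √(2 * κ * meanBudget Ah Al p) := by
        refine Real.sqrt_lt_sqrt hκA.le ?_
        rw [hmean]
        nlinarith [mul_pos hp0 hΔ]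
      have hb1 : √(2 * κ * meanBudget Ah Al p) < 1 := by
        rw [← Real.sqrt_one]; exact Real.sqrt_lt_sqrt (by positivity) hcp.1
      refine both_lt (x := √(1 - p)) ha0 hab hb1 ?_ (Real.sqrt_le_one.2 (by linarith)) ?_
      -- Cost below the threshold means xA_h < R + P; multiplying by x and using 1 ≤ x²A_h yields
      -- the inequality required by `both_lt`.
      · obtain ⟨x, hx, hx2⟩ := exists_sqrt_two_mul hκ
        have hlt := hcp.2
        rw [hx2, lt_lam_iff hAh0 hx.le] at hlt
        have h2κ : 2 * κ = x ^ 2 := by rw [hx2]; ring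
        rw [h2κ, Real.sqrt_mul (sq_nonneg x), Real.sqrt_mul (sq_nonneg x), Real.sqrt_sq hx.le]
        rw [Real.sqrt_mul (by linarith)] at hlt
        rw [h2κ] at hH
        nlinarith
      · rw [ha2, hb2, hw₀', hmean]
        ring
    · have n1 : ¬ (0 < p ∧ 1 ≤ 2 * κ * Ah ∧ ContestsBoth Ah Al κ p) :=
        fun h => not_contestsBoth_of_contestsLow hcp h.2.2
      have hAlt := hcp.lt_mul_sub hAl hAh hκ hp0 hp1.le
      by_cases hlt : signalValue Ah Al κ p 1 < signalValue Ah Al κ p w₀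
      · right; left
        have hmax := isStrictMaximizer_of_threshold ha1 hpw₀ hw₀1 hlow hhigh hlt
        rw [hlow w₀ hpw₀ le_rfl, one_low hcp] at hlt
        -- In the equality case w₀ = p, full disclosure, which cannot beat the trivial policy; hence
        -- the strict inequality in condition 2.
        have hne : 1 < 2 * κ * Ah := by
          refine hH.lt_of_ne fun h => ?_
          have : w₀ = p := by rw [hw₀, ← h]; simp
          rw [this] at hlt
          have hr2 : √(1 - p) ^ 2 = 1 - p := Real.sq_sqrt (by linarith)
          have hr1 : √(1 - p) ≤ 1 := Real.sqrt_le_one.2 (by linarith)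
          have hr0 : 0 ≤ √(1 - p) := Real.sqrt_nonneg _
          have := mul_nonneg (mul_nonneg hr0 (sub_nonneg.2 hr1)) ha0.le
          nlinarith
        refine ⟨Or.inr ⟨hp0, hcp.1, hne, hΔ1, hAlt, ?_⟩, n3, hmax⟩
        have := (low_lt_iff hp0 hp1 ha1 (div_pos (by linarith) hD)).1 hlt
        rwa [one_div_div] at this
      · left
        refine ⟨n1, fun h => hlt ?_, n3, le_of_threshold ha1 hpw₀ hlow hhigh (not_lt.1 hlt)⟩
        rw [hlow w₀ hpw₀ le_rfl, one_low hcp]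
        refine (low_lt_iff hp0 hp1 ha1 (div_pos (by linarith [h.2.2.1]) hD)).2 ?_
        rw [one_div_div]
        exact h.2.2.2.2.2
  · have hlam := lam_le_of hΔ1
    have hcp : ContestsLow Ah Al κ p := hcp.resolve_left fun h => not_lt.2 hlam h.2
    have hAlt := hcp.lt_mul_sub hAl hAh hκ hp0 hp1.le
    -- Solves 1 - p/w = 2κA_ℓ for w; now this constraint implies the one on the mean budget.
    set w₀ := p + p * (2 * κ * Al / (1 - 2 * κ * Al)) with hw₀
    have hQ : 0 < 2 * κ * Al / (1 - 2 * κ * Al) := by positivity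
    have hw₀' : w₀ * (1 - 2 * κ * Al) = p := by
      rw [hw₀]; field_simp; ring
    have hpw₀ : p ≤ w₀ := by rw [hw₀]; nlinarith
    have thr : ∀ w, p ≤ w → w ≤ 1 → ((¬ ContestsBoth Ah Al κ (p / w) ∧
        ¬ ContestsLow Ah Al κ (p / w)) ↔ w ≤ w₀) := by
      intro w hw hw1
      obtain ⟨hw0, hμ0, hμ1⟩ := hμ w hw
      have h1 : 1 - p / w ≤ 2 * κ * Al ↔ w ≤ w₀ := by
        rw [show w ≤ w₀ ↔ w * _ ≤ w₀ * _ from (mul_le_mul_iff_left₀ hD).symm, hw₀', sub_le_comm, le_div_iff₀ hw0, mul_comm w]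
      rw [not_contests_iff hAl hAh hκ hμ0.le hμ1, h1, and_iff_right_iff_imp, ← h1, hmean]
      intro h
      nlinarith
    have hw₀1 := not_p_of w₀ thr
    have hlow := low_of_thr w₀ thr
    have hhigh := high_of_thr w₀ hpw₀ thr
    have n1 : ¬ (0 < p ∧ 1 ≤ 2 * κ * Ah ∧ ContestsBoth Ah Al κ p) :=
      fun h => not_contestsBoth_of_contestsLow hcp h.2.2
    have hf : 1 < fp p := by
      have hr0 : 0 < √(1 - p) := Real.sqrt_pos.2 (by linarith)
      rw [fp_eq hp0 hp1, lt_div_iff₀ hr0]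
      linarith
    have key : signalValue Ah Al κ p 1 < signalValue Ah Al κ p w₀ ↔
        ((fp p - √(fp p ^ 2 - fp p + 1)) / (fp p - 1)) ^ 2 < 2 * κ * Al := by
      have h2 := root_sq_lt_iff hf ha0 ha1
      rw [ha2] at h2
      rw [hlow w₀ hpw₀ le_rfl, one_low hcp, h2]
      exact low_lt_iff hp0 hp1 ha1 hQ
    by_cases hlt : signalValue Ah Al κ p 1 < signalValue Ah Al κ p w₀
    · right; right
      exact ⟨n1, fun h => by linarith [h.2.2.2.1], ⟨hp0, hΔ1, key.1 hlt, hcp.2, hAlt⟩,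
        isStrictMaximizer_of_threshold ha1 hpw₀ hw₀1 hlow hhigh hlt⟩
    · left
      exact ⟨n1, fun h => by linarith [h.2.2.2.1], fun h => hlt (key.2 h.2.2.1),
        le_of_threshold ha1 hpw₀ hlow hhigh (not_lt.1 hlt)⟩

end Comparison

/-! ### From signaling policies to signal probabilities, and scaling by the total value -/

section Equilibrium

variable {n : ℕ} {v : Fin n → ℝ} {Ah Al p c : ℝ} {E : ℝ → ℝ → Profile n}

theorem SignalingPolicy.low_high_eq_zero (σ : SignalingPolicy) : σ.prob .low .high = 0 := by
  linarith [σ.sum_eq_one .high, σ.truthful]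

theorem SignalingPolicy.low_low_eq (σ : SignalingPolicy) :
    σ.prob .low .low = 1 - σ.prob .high .low := by
  linarith [σ.sum_eq_one .low]

theorem SignalingPolicy.high_low_le_one (σ : SignalingPolicy) : σ.prob .high .low ≤ 1 := by
  linarith [σ.sum_eq_one .low, σ.nonneg .low .low]

/-- The policy that sends the high signal with probability `q` when the budget is low. -/
def policyOf (q : ℝ) (hq0 : 0 ≤ q) (hq1 : q ≤ 1) : SignalingPolicy where
  prob s t := match s, t with
    | .high, .high => 1
    | .high, .low => q
    | .low, .high => 0
    | .low, .low => 1 - q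
  nonneg s t := by
    cases s <;> cases t <;> simp only <;> linarith
  sum_eq_one t := by cases t <;> simp
  truthful := rfl

theorem posterior_low (p : ℝ) (σ : SignalingPolicy) : posterior p σ .low = 0 := by
  unfold posterior
  rw [σ.low_high_eq_zero]
  simp

theorem posterior_high (p : ℝ) (σ : SignalingPolicy) :
    posterior p σ .high = p / (p + (1 - p) * σ.prob .high .low) := by
  unfold posterior
  rw [σ.truthful, mul_one]

theorem posterior_mem (hp0 : 0 ≤ p) (hp1 : p ≤ 1) (σ : SignalingPolicy) (s : BudgetType) :
    posterior p σ s ∈ Set.Icc (0 : ℝ) 1 := by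
  cases s
  · rw [posterior_high]
    have h := mul_nonneg (sub_nonneg.2 hp1) (σ.nonneg .high .low)
    exact ⟨by positivity, div_le_one_of_le₀ (by linarith) (by positivity)⟩
  · rw [posterior_low]
    exact ⟨le_rfl, zero_le_one⟩

/-- Investments that are the least optimal ones determine player A's payoff. -/
theorem expectedPayoff_eq (hn : 0 < n) (hv : ∀ j, 0 < v j) (hAl : 0 < Al) (hAh : Al ≤ Ah)
    (hp0 : 0 ≤ p) (hp1 : p ≤ 1) (hc : 0 < c) (hE : IsEquilibriumSelection v Ah Al E)
    {Bstar : ℝ → ℝ}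
    (hopt : ∀ (τ : SignalingPolicy) (s : BudgetType),
      Bstar (posterior p τ s) ∈ optimalInvestments v c E (posterior p τ s))
    (hleast : InvestsLeast v p c E Bstar) (σ : SignalingPolicy) :
    expectedPayoff v p E Bstar σ = totalValue v *
      signalValue Ah Al (c / totalValue v) p (p + (1 - p) * σ.prob .high .low) := by
  have hφ := totalValue_pos hn hv
  have key : ∀ s, utilB v (posterior p σ s) (E (posterior p σ s) (Bstar (posterior p σ s))) =
      totalValue v * (1 - residual Ah Al (c / totalValue v) (posterior p σ s)) := by
    intro s
    have hm := posterior_mem hp0 hp1 σ s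
    obtain ⟨B, hB, hB', hval⟩ := exists_least_investment hn hv hAl hAh hE hm.1 hm.2 hc
    have : Bstar (posterior p σ s) = B :=
      le_antisymm (hleast σ s B hB) (hB' _ (hopt σ s))
    rw [this, ← hval, mul_div_cancel₀ _ hφ.ne']
  have kh := key .high
  have kl := key .low
  rw [utilB_eq] at kh kl
  unfold expectedPayoff signalValue
  simp only
  rw [σ.truthful, σ.low_high_eq_zero, σ.low_low_eq]
  rw [posterior_low] at kl ⊢
  have hq0 := σ.nonneg .high .low
  have hw0 : 0 ≤ p + (1 - p) * σ.prob .high .low :=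
    add_nonneg hp0 (mul_nonneg (sub_nonneg.2 hp1) hq0)
  -- Conditional on the high signal the types carry the weights m and 1 - m that B's utility uses,
  -- so A's payoff is the total value minus B's and the payoffs of the single types drop out. The
  -- identity also holds when the signal has probability zero, since then p = 0.
  have hpw : p = (p + (1 - p) * σ.prob .high .low) * posterior p σ .high := by
    rw [posterior_high]
    rcases hw0.eq_or_lt with h | h
    · have : p = 0 := by
        have := mul_nonneg (sub_nonneg.2 hp1) hq0
        linarith
      rw [← h, this, zero_mul]
    · rw [mul_div_cancel₀ _ h.ne']
  have hqw : (1 - p) * σ.prob .high .low =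
      (p + (1 - p) * σ.prob .high .low) * (1 - posterior p σ .high) := by
    linear_combination -hpw
  rw [← posterior_high] at *
  set m := posterior p σ .high
  set πh := utilA v (E m (Bstar m)) .high
  set πl := utilA v (E m (Bstar m)) .low
  linear_combination πh * hpw + πl * hqw - (p + (1 - p) * σ.prob .high .low) * kh -
    (1 - p) * (1 - σ.prob .high .low) * kl

/-- The condition is homogeneous in (φ, c), so everything can be computed at total value 1 and cost
κ. -/
theorem region1_scale {φ : ℝ} (hφ : 0 < φ) :
    Region1 φ Ah Al c p ↔ Region1 1 Ah Al (c / φ) p := by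
  unfold Region1
  have h1 : lam φ Ah Al p = φ * lam 1 Ah Al p := by unfold lam; ring
  rw [h1, lt_min_iff, lt_min_iff, le_div_iff₀ hφ, div_lt_iff₀ hφ, div_lt_iff₀ hφ,
    one_div_mul_eq_div, one_div_mul_eq_div, mul_comm φ]

theorem region2_scale {φ : ℝ} (hφ : 0 < φ) :
    Region2 φ Ah Al c p ↔ Region2 1 Ah Al (c / φ) p := by
  unfold Region2
  have h1 : lam φ Ah Al p = φ * lam 1 Ah Al p := by unfold lam; ring
  have h2 : √(c * φ * Al / 2) = φ * √(c / φ * 1 * Al / 2) := by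
    rw [show c * φ * Al / 2 = φ ^ 2 * (c / φ * 1 * Al / 2) by field_simp,
      Real.sqrt_mul (sq_nonneg _), Real.sqrt_sq hφ.le]
  have h3 : (φ - 2 * c * Al) / (2 * c * Ah - φ) =
      (1 - 2 * (c / φ) * Al) / (2 * (c / φ) * Ah - 1) := by
    rw [← mul_div_mul_left (1 - 2 * (c / φ) * Al) _ hφ.ne']
    congr 1 <;> field_simp
  rw [h1, h2, h3, show φ - φ * √(c / φ * 1 * Al / 2) = φ * (1 - √(c / φ * 1 * Al / 2)) by ring,
    mul_div_mul_left _ _ hφ.ne', le_div_iff₀ hφ, lt_div_iff₀ hφ, div_lt_iff₀ hφ,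
    one_div_mul_eq_div, one_div_mul_eq_div, mul_comm φ]

theorem region3_scale {φ : ℝ} (hφ : 0 < φ) :
    Region3 φ Ah Al c p ↔ Region3 1 Ah Al (c / φ) p := by
  unfold Region3
  rw [le_div_iff₀ hφ, lt_div_iff₀ hφ, div_lt_iff₀ hφ, one_div_mul_eq_div,
    show ∀ y, 1 / (2 * Al) * y * φ = φ / (2 * Al) * y from fun y => by ring,
    show (1 - p) * 1 / (2 * Al) * φ = (1 - p) * φ / (2 * Al) by ring]

end Equilibrium

end LottoSignaling

/-! ### The main theorem -/

theorem theorem1 (n : ℕ) (hn : 0 < n) (v : Fin n → ℝ) (hv : ∀ j, 0 < v j)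
    (Ah Al p c : ℝ) (hAl : 0 < Al) (hAh : Al ≤ Ah) (hp0 : 0 ≤ p) (hp1 : p ≤ 1) (hc : 0 < c) :
    (∃ E : ℝ → ℝ → Profile n, IsEquilibriumSelection v Ah Al E) ∧
    ∀ E : ℝ → ℝ → Profile n, IsEquilibriumSelection v Ah Al E →
      (∃ (σ : SignalingPolicy) (Bstar : ℝ → ℝ),
        IsSPE v p c E σ Bstar ∧ InvestsLeast v p c E Bstar) ∧
      ∀ (σ : SignalingPolicy) (Bstar : ℝ → ℝ),
        IsSPE v p c E σ Bstar → InvestsLeast v p c E Bstar →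
        (expectedPayoff v p E Bstar trivialPolicy < expectedPayoff v p E Bstar σ ↔
          Region1 (totalValue v) Ah Al c p ∨ Region2 (totalValue v) Ah Al c p ∨
            Region3 (totalValue v) Ah Al c p) ∧
        (Region1 (totalValue v) Ah Al c p ∨ Region2 (totalValue v) Ah Al c p →
          σ.prob .high .low =
            p / (1 - p) * ((2 * c * Ah - totalValue v) / (totalValue v - 2 * c * Al))) ∧
        (Region3 (totalValue v) Ah Al c p →
          σ.prob .high .low = p / (1 - p) * (2 * c * Al / (totalValue v - 2 * c * Al))) := by
  refine ⟨exists_isEquilibriumSelection hn hv hAl hAh, fun E hE => ?_⟩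
  have hφ := totalValue_pos hn hv
  have hpay := fun {Bstar : ℝ → ℝ} => expectedPayoff_eq (Bstar := Bstar) hn hv hAl hAh hp0 hp1 hc hE
  rw [region1_scale hφ, region2_scale hφ, region3_scale hφ]
  set κ := c / totalValue v with hκ
  have hκ0 : 0 < κ := by positivity
  -- a maximizer of the payoff, and a description of all maximizers
  have hmain : (∃ w₀, p ≤ w₀ ∧ w₀ ≤ 1 ∧ ∀ w, p ≤ w → w ≤ 1 →
      signalValue Ah Al κ p w ≤ signalValue Ah Al κ p w₀) ∧
      ∀ w₀, p ≤ w₀ → w₀ ≤ 1 → (∀ w, p ≤ w → w ≤ 1 →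
        signalValue Ah Al κ p w ≤ signalValue Ah Al κ p w₀) →
      (signalValue Ah Al κ p 1 < signalValue Ah Al κ p w₀ ↔
        Region1 1 Ah Al κ p ∨ Region2 1 Ah Al κ p ∨ Region3 1 Ah Al κ p) ∧
      (Region1 1 Ah Al κ p ∨ Region2 1 Ah Al κ p → p < 1 ∧
        w₀ = p + p * ((2 * κ * Ah - 1) / (1 - 2 * κ * Al))) ∧
      (Region3 1 Ah Al κ p → p < 1 ∧ w₀ = p + p * (2 * κ * Al / (1 - 2 * κ * Al))) := by
    by_cases hp : 0 < p ∧ p < 1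
    · obtain ⟨hp0', hp1'⟩ := hp
      have strict : ∀ {w₁}, IsStrictMaximizer (signalValue Ah Al κ p) p w₁ →
          (∃ w₀, p ≤ w₀ ∧ w₀ ≤ 1 ∧ ∀ w, p ≤ w → w ≤ 1 →
            signalValue Ah Al κ p w ≤ signalValue Ah Al κ p w₀) ∧
          ∀ w₀, p ≤ w₀ → w₀ ≤ 1 → (∀ w, p ≤ w → w ≤ 1 →
            signalValue Ah Al κ p w ≤ signalValue Ah Al κ p w₀) → w₀ = w₁ := by
        rintro w₁ ⟨h1, h2, h3, h4⟩
        refine ⟨⟨w₁, h1, h2, fun w hw hw' => ?_⟩, fun w₀ h5 h6 h7 => ?_⟩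
        · rcases eq_or_ne w w₁ with rfl | h
          · exact le_rfl
          · exact (h4 w hw hw' h).le
        · by_contra h
          exact absurd (h4 w₀ h5 h6 h) (not_lt.2 (h7 w₁ h1 h2))
      rcases signalValue_trichotomy hAl hAh hκ0 hp0' hp1' with
        ⟨n1, n2, n3, h⟩ | ⟨h12, n3, h⟩ | ⟨n1, n2, h3, h⟩
      · refine ⟨⟨1, hp1, le_rfl, h⟩, fun w₀ h1 h2 _ => ⟨?_, ?_, ?_⟩⟩
        · exact iff_of_false (not_lt.2 (h w₀ h1 h2)) (by tauto)
        · tauto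
        · tauto
      · obtain ⟨e1, e2⟩ := strict h
        refine ⟨e1, fun w₀ h1 h2 h3 => ?_⟩
        obtain rfl := e2 w₀ h1 h2 h3
        exact ⟨iff_of_true h.2.2.1 (by tauto), fun _ => ⟨hp1', rfl⟩, fun h' => absurd h' n3⟩
      · obtain ⟨e1, e2⟩ := strict h
        refine ⟨e1, fun w₀ h1 h2 h3' => ?_⟩
        obtain rfl := e2 w₀ h1 h2 h3'
        exact ⟨iff_of_true h.2.2.1 (by tauto), fun h' => by tauto, fun _ => ⟨hp1', rfl⟩⟩
    -- For p = 0 or p = 1 all three conditions fail, and signaling is idle: the high-signal belief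
    -- is always 0, or only w = 1 is possible.
    · have hreg : ¬ Region1 1 Ah Al κ p ∧ ¬ Region2 1 Ah Al κ p ∧ ¬ Region3 1 Ah Al κ p := by
        rw [region1_one_iff hAl hAh, region2_one_iff hAl hAh, region3_one_iff hAl hAh]
        have hp' : 0 < p → p = 1 := fun h => le_antisymm hp1 (not_lt.1 fun h' => hp ⟨h, h'⟩)
        refine ⟨fun h => ?_, fun h => ?_, fun h => ?_⟩
        · obtain rfl := hp' h.1
          have h1 := h.2.2.1
          rw [show meanBudget Ah Al 1 = Ah by unfold meanBudget; ring] at h1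
          linarith [h.2.1]
        · obtain rfl := hp' h.1
          have h1 := h.2.2.2.2.1
          simp at h1
          linarith
        · obtain rfl := hp' h.1
          have h1 := h.2.2.2.2
          simp at h1
          linarith
      have hconst : ∀ w, p ≤ w → w ≤ 1 →
          signalValue Ah Al κ p w = signalValue Ah Al κ p 1 := by
        intro w hw hw1
        rcases hp0.eq_or_lt with rfl | h
        · unfold signalValue
          simp only [zero_div]
          ring
        · rw [le_antisymm hw1 ((not_lt.1 fun h' => hp ⟨h, h'⟩).trans hw)]
      refine ⟨⟨1, hp1, le_rfl, fun w hw hw1 => (hconst w hw hw1).le⟩, fun w₀ h1 h2 _ => ?_⟩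
      exact ⟨iff_of_false (by rw [hconst w₀ h1 h2]; exact lt_irrefl _) (by tauto), by tauto,
        by tauto⟩
  obtain ⟨⟨w₁, hw₁, hw₁', hmax⟩, hall⟩ := hmain
  have mem_w : ∀ σ : SignalingPolicy, p ≤ p + (1 - p) * σ.prob .high .low ∧
      p + (1 - p) * σ.prob .high .low ≤ 1 := fun σ => by
    have h1 := mul_nonneg (sub_nonneg.2 hp1) (σ.nonneg .high .low)
    have h2 := mul_nonneg (sub_nonneg.2 hp1) (sub_nonneg.2 σ.high_low_le_one)
    constructor <;> linarith
  have exists_policy : ∀ w, p ≤ w → w ≤ 1 →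
      ∃ σ : SignalingPolicy, p + (1 - p) * σ.prob .high .low = w := by
    intro w hw hw1
    rcases hp1.eq_or_lt with h | h
    · exact ⟨trivialPolicy, by rw [h] at hw ⊢; linarith⟩
    · have hp' : 0 < 1 - p := by linarith
      refine ⟨policyOf ((w - p) / (1 - p)) (div_nonneg (by linarith) hp'.le)
        ((div_le_one hp').2 (by linarith)), ?_⟩
      show p + (1 - p) * ((w - p) / (1 - p)) = w
      rw [mul_div_cancel₀ _ hp'.ne']
      ring
  constructor
  · have hB : ∀ μ, ∃ B, μ ∈ Set.Icc (0 : ℝ) 1 → B ∈ optimalInvestments v c E μ ∧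
        ∀ B' ∈ optimalInvestments v c E μ, B ≤ B' := by
      intro μ
      by_cases hμ : μ ∈ Set.Icc (0 : ℝ) 1
      · obtain ⟨B, h1, h2, -⟩ := exists_least_investment hn hv hAl hAh hE hμ.1 hμ.2 hc
        exact ⟨B, fun _ => ⟨h1, h2⟩⟩
      · exact ⟨0, fun h => absurd h hμ⟩
    choose Bstar hBstar using hB
    have hopt : ∀ (τ : SignalingPolicy) (s : BudgetType),
        Bstar (posterior p τ s) ∈ optimalInvestments v c E (posterior p τ s) :=
      fun τ s => (hBstar _ (posterior_mem hp0 hp1 τ s)).1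
    have hleast : InvestsLeast v p c E Bstar :=
      fun τ s => (hBstar _ (posterior_mem hp0 hp1 τ s)).2
    obtain ⟨σ, hσ⟩ := exists_policy w₁ hw₁ hw₁'
    refine ⟨σ, Bstar, ⟨hopt, fun τ => ?_⟩, hleast⟩
    rw [hpay hopt hleast, hpay hopt hleast, hσ]
    exact mul_le_mul_of_nonneg_left (hmax _ (mem_w τ).1 (mem_w τ).2) hφ.le
  · intro σ Bstar hspe hleast
    have hpay' := hpay hspe.investment hleast
    obtain ⟨h1, h2, h3⟩ := hall _ (mem_w σ).1 (mem_w σ).2 (fun w hw hw1 => by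
      obtain ⟨τ, hτ⟩ := exists_policy w hw hw1
      have h := hspe.signaling τ
      rw [hpay', hpay', hτ] at h
      exact le_of_mul_le_mul_left h hφ)
    have htriv : p + (1 - p) * trivialPolicy.prob .high .low = 1 := by
      show p + (1 - p) * 1 = 1
      ring
    -- Inverts w = p + (1-p)q at w = p + pQ.
    have solve : ∀ {Q : ℝ}, p < 1 → p + (1 - p) * σ.prob .high .low = p + p * Q →
        σ.prob .high .low = p / (1 - p) * Q := fun hp h => by
      have : 0 < 1 - p := by linarith
      field_simp
      linarith
    refine ⟨?_, fun h => ?_, fun h => ?_⟩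
    · rw [hpay', hpay', htriv, mul_lt_mul_iff_right₀ hφ]
      exact h1
    · rw [solve (h2 h).1 (h2 h).2, ← mul_div_mul_left (2 * κ * Ah - 1) _ hφ.ne']
      congr 2 <;> rw [hκ] <;> field_simp
    · rw [solve (h3 h).1 (h3 h).2, ← mul_div_mul_left (2 * κ * Al) _ hφ.ne']
      congr 2 <;> rw [hκ] <;> field_simp
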